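/- Let $\mathcal M$ be a Markov automaton with finite state space $S$ and finite action set, all of whose actions are internal. Each state $s$ has at least one outgoing transition, and each action $\alpha$ enabled in $s$ determines a unique distribution $\mu^s_\alpha$ on $S$. There are finitely many Markovian transitions, each with a positive rate. A state is *probabilistic* if it has a probabilistic transition (by maximal progress, its Markovian transitions are then never taken); otherwise it is *Markovian*. Let $MS$ be the set of Markovian states, $\mathbf R(s,s')$ the sum of the rates of the Markovian transitions from $s$ to $s'$, $E(s)=\sum_{s'}\mathbf R(s,s')$ and $\mathbf P(s,s')=\mathbf R(s,s')/E(s)$ for $s\in MS$. In a probabilistic state a policy picks (possibly at random) an enabled action $\alpha$, and the automaton moves without delay to a state chosen by $\mu^s_\alpha$. In a Markovian state it stays for an exponentially distributed time with rate $E(s)$ and then, independently of that time, moves to a state chosen by $\mathbf P(s,\cdot)$. For $G\subseteq S$ and $b\ge 0$, let $p^{\mathcal M}_{\max}(s,\Diamond^{[0,b]}G)$ be the supremum, over all measurable randomised policies that may depend on the whole history (states, actions and residence times), of the probability that a path from $s$ is in $G$ at some time in $[0,b]$. For $\delta>0$, the discretised automaton $\mathcal M_\delta$ has the same states and probabilistic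 transitions as $\mathcal M$, and in each Markovian state $s$ it makes one step to a state chosen by $\mu^s$, where $\mu^s(s')=(1-e^{-E(s)\delta})\,\mathbf P(s,s')$ for $s'\neq s$ and $\mu^s(s)=(1-e^{-E(s)\delta})\,\mathbf P(s,s)+e^{-E(s)\delta}$. Only the transitions of Markovian states count as steps. Let $p^{\mathcal M_\delta}_{\max}(s,\Diamond^{[0,k]}G)$ be the supremum, over all randomised policies that may depend on the history of states and transitions, of the probability that a path of $\mathcal M_\delta$ from $s$ reaches $G$ within $k$ steps. **Theorem.** Suppose $MS\ne\emptyset$ and let $\lambda=\max_{s\in MS}E(s)$. Let $G\subseteq S$, $\delta>0$ and $b=k_b\delta$ with $k_b\in\mathbb N=\{0,1,2,\dots\}$. Then for all $s\in S$, $$p^{\mathcal M_\delta}_{\max}(s,\Diamond^{[0,k_b]}G)\ \le\ p^{\mathcal M}_{\max}(s,\Diamond^{[0,b]}G)\ \le\ p^{\mathcal M_\delta}_{\max}(s,\Diamond^{[0,k_b]}G)+1-e^{-\lambda b}(1+\lambda\delta)^{k_b}.$$ -/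

import Mathlib

open MeasureTheory ProbabilityTheory
open scoped NNReal ENNReal

noncomputable section

/-! ### Markov automata -/

/-- A (closed) Markov automaton with finite state type `S` and finite set of actions `Act`.
All actions are internal, i.e. executed without delay, and each action enabled in a state
determines a unique distribution: `prob s α = some μ` means that there is a probabilistic
transition from `s` labelled `α` with distribution `μ`, and `prob s α = none` means that `α` is
not enabled in `s`. A triple `(s, r, s')` in `markov` is a Markovian transition from `s` to `s'`
with rate `r`. As paths are infinite, every state has an outgoing transition. -/
structure MarkovAutomaton (S Act : Type*) where
  /-- the initial state -/
  init : S
  /-- the probabilistic transitions -/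
  prob : S → Act → Option (PMF S)
  /-- the Markovian transitions -/
  markov : Finset (S × ℝ × S)
  rate_pos : ∀ x ∈ markov, 0 < x.2.1
  exists_transition : ∀ s, (∃ α μ, prob s α = some μ) ∨ ∃ r s', (s, r, s') ∈ markov

/-- The labels `Act ∪ {⊥}` of the steps of a path: an action of a probabilistic transition, or
`bot` for a Markovian transition (in a discretised automaton, for one time step). -/
inductive StepLabel (Act : Type*) where
  | bot : StepLabel Act
  | act (α : Act) : StepLabel Act

namespace StepLabel

variable {Act : Type*}

instance : MeasurableSpace (StepLabel Act) := ⊤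

instance : DiscreteMeasurableSpace (StepLabel Act) := ⟨fun _ => trivial⟩

/-- The number of discretisation steps that a step of a discretised automaton takes: probabilistic
transitions are instantaneous. -/
def ticks : StepLabel Act → ℕ
  | bot => 1
  | act _ => 0

instance [Finite Act] : Finite (StepLabel Act) :=
  Finite.of_surjective
    (fun o : Option Act => match o with
      | none => bot
      | some α => act α)
    (fun l => match l with
      | bot => ⟨none, rfl⟩
      | act α => ⟨some α, rfl⟩)

end StepLabel

namespace MarkovAutomaton

variable {S Act : Type*} (M : MarkovAutomaton S Act)

/-- Probabilistic states: those with an outgoing probabilistic transition. By maximal progress,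
Markovian transitions of such states are never taken. -/
def PS : Set S := {s | ∃ α μ, M.prob s α = some μ}

/-- Markovian states: those all of whose outgoing transitions are Markovian. -/
def MS : Set S := M.PSᶜ

open Classical in
/-- The total rate `R(s, s')` of moving from `s` to `s'`. -/
def rate (s s' : S) : ℝ := ∑ x ∈ M.markov with x.1 = s ∧ x.2.2 = s', x.2.1

open Classical in
lemma rate_nonneg (s s' : S) : 0 ≤ M.rate s s' :=
  Finset.sum_nonneg fun x hx => (M.rate_pos x (Finset.mem_filter.1 hx).1).le

/-- The exit rate `E(s)`. -/
def exitRate [Fintype S] (s : S) : ℝ := ∑ s', M.rate s s'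

open Classical in
lemma exitRate_pos [Fintype S] {s : S} (hs : s ∈ M.MS) : 0 < M.exitRate s := by
  rcases M.exists_transition s with h | ⟨r, s', h⟩
  · exact absurd h hs
  · refine Finset.sum_pos' (fun t _ => M.rate_nonneg s t) ⟨s', Finset.mem_univ _, ?_⟩
    exact Finset.sum_pos (fun x hx => M.rate_pos x (Finset.mem_filter.1 hx).1)
      ⟨(s, r, s'), by simp [h]⟩

/-- The branching distribution `P(s, ·) = R(s, ·) / E(s)` of a Markovian state. -/
def branch [Fintype S] (s : S) (hs : s ∈ M.MS) : PMF S :=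
  PMF.ofFintype (fun s' => ENNReal.ofReal (M.rate s s' / M.exitRate s)) (by
    have hE := M.exitRate_pos hs
    rw [← ENNReal.ofReal_sum_of_nonneg (fun t _ => div_nonneg (M.rate_nonneg s t) hE.le),
      ← Finset.sum_div]
    change ENNReal.ofReal (M.exitRate s / M.exitRate s) = 1
    rw [div_self hE.ne', ENNReal.ofReal_one])

end MarkovAutomaton

/-! ### Controlled processes

`X` is the type of the elements of a path; `en x` is the set of labels that are enabled after a
finite path with last element `x`, and `step (x, l)` is the law of the next element if label `l` is
chosen. -/

/-- The last element of a finite path. -/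
def lastOf {X : Type*} {n : ℕ} (h : Finset.Iic n → X) : X := h ⟨n, Finset.mem_Iic.2 le_rfl⟩

lemma measurable_lastOf {X : Type*} [MeasurableSpace X] {n : ℕ} :
    Measurable (lastOf (X := X) (n := n)) := measurable_pi_apply _

/-- A history-dependent randomised measurable policy: it measurably assigns to each finite path a
probability distribution over the labels that are enabled after it. -/
structure Policy (X L : Type*) [MeasurableSpace X] [MeasurableSpace L] (en : X → Set L) where
  choice : ∀ n : ℕ, Kernel (Finset.Iic n → X) L
  isMarkov : ∀ n, IsMarkovKernel (choice n)
  enabled : ∀ n h l, choice n h {l} ≠ 0 → l ∈ en (lastOf h)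

attribute [instance] Policy.isMarkov

namespace Policy

variable {X L : Type*} [MeasurableSpace X] [MeasurableSpace L] {en : X → Set L}

/-- The law of the next element given a finite path: choose a label, then make a step. -/
def next (D : Policy X L en) (step : Kernel (X × L) X) (n : ℕ) : Kernel (Finset.Iic n → X) X :=
  step ∘ₖ (Kernel.deterministic lastOf measurable_lastOf ×ₖ D.choice n)

instance (D : Policy X L en) (step : Kernel (X × L) X) [IsMarkovKernel step] (n : ℕ) :
    IsMarkovKernel (D.next step n) := by
  unfold next
  infer_instance

/-- The probability measure on infinite paths with initial element `x₀` (Ionescu-Tulcea). -/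
def pathMeasure (D : Policy X L en) (step : Kernel (X × L) X) [IsMarkovKernel step] (x₀ : X) :
    Measure (ℕ → X) :=
  Kernel.traj (X := fun _ => X) (D.next step) 0 (fun _ => x₀)

instance (D : Policy X L en) (step : Kernel (X × L) X) [IsMarkovKernel step] (x₀ : X) :
    IsProbabilityMeasure (D.pathMeasure step x₀) := by
  unfold pathMeasure
  infer_instance

end Policy

/-! ### Timed reachability in Markov automata

An infinite path `s₀ -(σ₀, t₀)→ s₁ -(σ₁, t₁)→ ⋯` is encoded as the sequence
`(⊥, 0, s₀), (σ₀, t₀, s₁), (σ₁, t₁, s₂), …` with a dummy label and time in its first element. The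
distributions `μᵢ` along a path are determined by the states and labels. -/

namespace MarkovAutomaton

variable {S Act : Type*} (M : MarkovAutomaton S Act)

/-- Elements of a path: a label and a residence time (of the preceding state), and the state that
is entered. -/
abbrev Elem (S Act : Type*) := StepLabel Act × ℝ≥0 × S

/-- The labels that are enabled in a state: the enabled actions in a probabilistic state, and `⊥`
in a Markovian state. -/
def enabled (s : S) : Set (StepLabel Act)
  | .act α => ∃ μ, M.prob s α = some μ
  | .bot => s ∈ M.MS

variable [Fintype S] [MeasurableSpace S]

open Classical in
/-- The law of the next element of a path when label `l` is chosen in state `s`: an enabled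
action takes no time and leads to a state chosen by its distribution; a Markovian transition takes
an exponentially distributed time with rate `E(s)` and leads, independently, to a state chosen by
`P(s, ·)`. (Labels that are not enabled are never chosen; the value is then irrelevant.) -/
def stepMeasure (s : S) : StepLabel Act → Measure (Elem S Act)
  | .act α =>
    match M.prob s α with
    | some μ => μ.toMeasure.map (fun s' => (.act α, 0, s'))
    | none => Measure.dirac (.act α, 0, s)
  | .bot =>
    if hs : s ∈ M.MS then
      (((expMeasure (M.exitRate s)).map Real.toNNReal).prod (M.branch s hs).toMeasure).map
        (fun p => (.bot, p.1, p.2))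
    else Measure.dirac (.bot, 0, s)

instance (s : S) (l : StepLabel Act) : IsProbabilityMeasure (M.stepMeasure s l) := by
  cases l with
  | act α =>
    rw [stepMeasure]
    split
    · exact Measure.isProbabilityMeasure_map (by fun_prop)
    · infer_instance
  | bot =>
    by_cases hs : s ∈ M.MS
    · have := isProbabilityMeasure_expMeasure (M.exitRate_pos hs)
      have : IsProbabilityMeasure ((expMeasure (M.exitRate s)).map Real.toNNReal) :=
        Measure.isProbabilityMeasure_map measurable_real_toNNReal.aemeasurable
      rw [stepMeasure, dif_pos hs]
      exact Measure.isProbabilityMeasure_map (by fun_prop)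
    · rw [stepMeasure, dif_neg hs]
      infer_instance

variable [DiscreteMeasurableSpace S] [Finite Act]

/-- `stepMeasure` as a Markov kernel. -/
def stepKernel : Kernel (Elem S Act × StepLabel Act) (Elem S Act) :=
  Kernel.comap (Kernel.ofFunOfCountable fun p : S × StepLabel Act => M.stepMeasure p.1 p.2)
    (fun q => (q.1.2.2, q.2)) (by fun_prop)

instance : IsMarkovKernel M.stepKernel :=
  ⟨fun q => inferInstanceAs (IsProbabilityMeasure (M.stepMeasure q.1.2.2 q.2))⟩

/-- The generic measurable policies: they may use the states, the labels and the residence times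
along a finite path. -/
abbrev GMPolicy :=
  Policy (Elem S Act) (StepLabel Act) (fun x => M.enabled x.2.2)

/-- The probability measure `Pr_{s,D}` on infinite paths. -/
def pathMeasure (D : M.GMPolicy) (s : S) : Measure (ℕ → Elem S Act) :=
  D.pathMeasure M.stepKernel (.bot, 0, s)

/-- The time elapsed along a path before its `n`-th state is entered. -/
def elapsed (ω : ℕ → Elem S Act) (n : ℕ) : ℝ := ∑ i ∈ Finset.range n, ((ω (i + 1)).2.1 : ℝ)

/-- The set of the states that a path occupies at time `t`. -/
def occupied (ω : ℕ → Elem S Act) (t : ℝ) : Set S :=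
  {s | ∃ n, (ω n).2.2 = s ∧ elapsed ω n ≤ t ∧ t ≤ elapsed ω (n + 1)}

/-- The set `◇^I G` of the paths that are in `G` at some time in `I`. -/
def reach (I : Set ℝ) (G : Set S) : Set (ℕ → Elem S Act) :=
  {ω | ∃ t ∈ I, ∃ s ∈ occupied ω t, s ∈ G}

/-- The maximal (over all generic measurable policies) probability of `◇^I G` from `s`. -/
def pmax (s : S) (I : Set ℝ) (G : Set S) : ℝ :=
  (⨆ D : M.GMPolicy, M.pathMeasure D s (reach I G)).toReal

end MarkovAutomaton

/-! ### Discretised Markov automata -/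

/-- A discretised Markov automaton: instantaneous probabilistic transitions, as in a Markov
automaton, and discretised Markovian transitions, `tick s = some μ` meaning that one time step leads
from `s` to the distribution `μ`. -/
structure DiscretisedMA (S Act : Type*) where
  init : S
  prob : S → Act → Option (PMF S)
  tick : S → Option (PMF S)

namespace MarkovAutomaton

variable {S Act : Type*} [Fintype S] (M : MarkovAutomaton S Act)

open Classical in
/-- The distribution `μˢ` of a Markovian state `s` over one discretisation step of length `δ`. -/
def tickDist (δ : ℝ) (hδ : 0 < δ) (s : S) (hs : s ∈ M.MS) : PMF S :=
  PMF.ofFintype (fun s' => ENNReal.ofReal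
    (if s' = s then
      (1 - Real.exp (-(M.exitRate s * δ))) * (M.rate s s' / M.exitRate s)
        + Real.exp (-(M.exitRate s * δ))
    else (1 - Real.exp (-(M.exitRate s * δ))) * (M.rate s s' / M.exitRate s))) (by
    have hE := M.exitRate_pos hs
    have h1 : Real.exp (-(M.exitRate s * δ)) ≤ 1 :=
      Real.exp_le_one_iff.2 (neg_nonpos.2 (mul_pos hE hδ).le)
    have h2 : ∀ t, 0 ≤ (1 - Real.exp (-(M.exitRate s * δ))) * (M.rate s t / M.exitRate s) :=
      fun t => mul_nonneg (sub_nonneg.2 h1) (div_nonneg (M.rate_nonneg s t) hE.le)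
    have h3 : ∑ t, M.rate s t / M.exitRate s = 1 := by
      rw [← Finset.sum_div]
      exact div_self hE.ne'
    have h4 : ∀ t, (if t = s then
        (1 - Real.exp (-(M.exitRate s * δ))) * (M.rate s t / M.exitRate s)
          + Real.exp (-(M.exitRate s * δ))
        else (1 - Real.exp (-(M.exitRate s * δ))) * (M.rate s t / M.exitRate s))
        = (1 - Real.exp (-(M.exitRate s * δ))) * (M.rate s t / M.exitRate s)
          + if t = s then Real.exp (-(M.exitRate s * δ)) else 0 := by
      intro t
      split_ifs <;> simp
    simp only [h4]
    rw [← ENNReal.ofReal_sum_of_nonneg, Finset.sum_add_distrib, ← Finset.mul_sum, h3]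
    · simp
    · intro t _
      exact add_nonneg (h2 t) (by split_ifs <;> positivity))

open Classical in
/-- The discretised Markov automaton induced by `M` and the discretisation step `δ`. -/
def discretise (δ : ℝ) (hδ : 0 < δ) : DiscretisedMA S Act where
  init := M.init
  prob := M.prob
  tick s := if hs : s ∈ M.MS then some (M.tickDist δ hδ s hs) else none

end MarkovAutomaton

namespace DiscretisedMA

variable {S Act : Type*} (N : DiscretisedMA S Act)

/-- Elements of a time-abstract path: a label and the state entered. A path
`s₀ -σ₀→ s₁ -σ₁→ ⋯` is encoded as `(⊥, s₀), (σ₀, s₁), (σ₁, s₂), …` with a dummy first label. -/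
abbrev Elem (S Act : Type*) := StepLabel Act × S

/-- The labels that are enabled in a state. -/
def enabled (s : S) : Set (StepLabel Act)
  | .act α => ∃ μ, N.prob s α = some μ
  | .bot => ∃ μ, N.tick s = some μ

variable [MeasurableSpace S]

/-- The law of the next element of a path when label `l` is chosen in state `s`. (Labels that
are not enabled are never chosen; the value is then irrelevant.) -/
def stepMeasure (s : S) (l : StepLabel Act) : Measure (Elem S Act) :=
  match (match l with
    | .act α => N.prob s α
    | .bot => N.tick s) with
  | some μ => μ.toMeasure.map (fun s' => (l, s'))
  | none => Measure.dirac (l, s)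

instance (s : S) (l : StepLabel Act) : IsProbabilityMeasure (N.stepMeasure s l) := by
  unfold stepMeasure
  split
  · exact Measure.isProbabilityMeasure_map (by fun_prop)
  · infer_instance

variable [Finite S] [DiscreteMeasurableSpace S] [Finite Act]

/-- `stepMeasure` as a Markov kernel. -/
def stepKernel : Kernel (Elem S Act × StepLabel Act) (Elem S Act) :=
  Kernel.comap (Kernel.ofFunOfCountable fun p : S × StepLabel Act => N.stepMeasure p.1 p.2)
    (fun q => (q.1.2, q.2)) (by fun_prop)

instance : IsMarkovKernel N.stepKernel :=
  ⟨fun q => inferInstanceAs (IsProbabilityMeasure (N.stepMeasure q.1.2 q.2))⟩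

/-- The time-abstract policies: they may use the states and the labels along a finite path. (The
measurability that is part of `Policy` is no restriction, as there are finitely many finite paths
of each length.) -/
abbrev TAPolicy :=
  Policy (Elem S Act) (StepLabel Act) (fun x => N.enabled x.2)

/-- The probability measure `Pr_{s,D}` on infinite time-abstract paths. -/
def pathMeasure (D : N.TAPolicy) (s : S) : Measure (ℕ → Elem S Act) :=
  D.pathMeasure N.stepKernel (.bot, s)

/-- The set `◇^{[0,k]} G` of the paths that reach `G` within `k` discretisation steps. -/
def reach (k : ℕ) (G : Set S) : Set (ℕ → Elem S Act) :=
  {ω | ∃ n, (ω n).2 ∈ G ∧ ∑ i ∈ Finset.range n, (ω (i + 1)).1.ticks ≤ k}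

/-- The maximal (over all time-abstract policies) probability of `◇^{[0,k]} G` from `s`. -/
def pmax (s : S) (k : ℕ) (G : Set S) : ℝ :=
  (⨆ D : N.TAPolicy, N.pathMeasure D s (reach k G)).toReal

end DiscretisedMA

end

noncomputable section


/-! ### Reachability under a controlled process with accumulated costs -/

section History

variable {X T : Type*}

/-! Both maximal probabilities are compared with `limValue`, written V_k(s): the limit over n of the
optimal probability, in the discretised automaton, of reaching G within n transitions and k time
steps. Every comparison is a dynamic-programming argument: a function of the current element and the
accumulated cost that is at most its own one-step expectation outside the target (a subsolution)
bounds hitting probabilities from its initial value. With value 1 on the target and 0 elsewhere at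
the horizon it bounds the probability of hitting from below (`exists_le_pathMeasure_hits`); with
value 0 on the target and at most 1 everywhere it bounds the probability of never hitting from below
(`pathMeasure_hits_add_le`). Upper bounds are thus lower bounds for avoidance, valid for every
policy, and no assumption on Zeno behaviour is needed.

In the discretised automaton, V_k is the maximal probability itself.

Lower bound. In continuous time, use an optimal label of the discretised automaton for the integral
part of (remaining time)/δ. Splitting an exponential residence time at δ and using memorylessness,
`value_le_jump` shows that a real residence does at least as well as the discretised one, which in
effect rounds each residence time up to a multiple of δ.

Upper bound. Discretisation loses only when several jumps fall into one interval. With q =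
e^{-λδ}(1+λδ), the probability of at most one event of a Poisson process of rate λ in an interval,
`avoid` is max(0, q^k - V_k). Between grid points it is multiplied by e^{-λc}, where c is the time
left to the next grid point; this `avoidBound` is a subsolution by `avoid_succ_le` and
memorylessness (`avoidBound_le_jump`). At b = kδ it gives probability at most 1 - q^k + V_k of
reaching G, and q^k = e^{-λb}(1+λδ)^k. -/

/-- The infinite sequence that extends a finite path by repeating its last element. -/
def extendPath {n : ℕ} (h : Finset.Iic n → X) (j : ℕ) : X :=
  h ⟨min j n, Finset.mem_Iic.2 (min_le_right _ _)⟩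

lemma extendPath_of_le {n j : ℕ} (h : Finset.Iic n → X) (hj : j ≤ n) :
    extendPath h j = h ⟨j, Finset.mem_Iic.2 hj⟩ := by
  simp [extendPath, hj]

lemma extendPath_frestrictLe {n j : ℕ} (ω : ℕ → X) (hj : j ≤ n) :
    extendPath (Preorder.frestrictLe (π := fun _ => X) n ω) j = ω j := by
  rw [extendPath_of_le _ hj]
  rfl

lemma measurable_extendPath [MeasurableSpace X] {n : ℕ} :
    Measurable (extendPath (X := X) (n := n)) :=
  measurable_pi_lambda _ fun _ => measurable_pi_apply _

variable [AddCommMonoid T]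

/-- The cost accumulated along a path before its `n`-th element. -/
def pathCost (c : X → T) (ω : ℕ → X) (n : ℕ) : T := ∑ i ∈ Finset.range n, c (ω (i + 1))

/-- The path visits `B`, in terms of elements and accumulated costs, within its first `n` steps. -/
def hitsBy (c : X → T) (B : Set (X × T)) (n : ℕ) : Set (ℕ → X) :=
  {ω | ∃ m ≤ n, (ω m, pathCost c ω m) ∈ B}

lemma pathCost_succ (c : X → T) (ω : ℕ → X) (n : ℕ) :
    pathCost c ω (n + 1) = pathCost c ω n + c (ω (n + 1)) := Finset.sum_range_succ _ _

lemma pathCost_congr (c : X → T) {ω ω' : ℕ → X} {n : ℕ} (h : ∀ j ≤ n, ω j = ω' j) :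
    pathCost c ω n = pathCost c ω' n :=
  Finset.sum_congr rfl fun i hi => by rw [h (i + 1) (Finset.mem_range.1 hi)]

/-- Only the elements up to index n matter, so the event can be evaluated on a finite history
through `extendPath`. -/
lemma mem_hitsBy_congr (c : X → T) (B : Set (X × T)) {ω ω' : ℕ → X} {n : ℕ}
    (h : ∀ j ≤ n, ω j = ω' j) : ω ∈ hitsBy c B n ↔ ω' ∈ hitsBy c B n := by
  refine exists_congr fun m => and_congr_right fun hm => ?_
  rw [h m hm, pathCost_congr c fun j hj => h j (hj.trans hm)]

lemma mem_hitsBy_succ (c : X → T) (B : Set (X × T)) (ω : ℕ → X) (n : ℕ) :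
    ω ∈ hitsBy c B (n + 1) ↔
      ω ∈ hitsBy c B n ∨ (ω (n + 1), pathCost c ω n + c (ω (n + 1))) ∈ B := by
  rw [← pathCost_succ]
  constructor
  · rintro ⟨m, hm, h⟩
    rcases Nat.lt_or_ge n m with h' | h'
    · obtain rfl : m = n + 1 := by omega
      exact Or.inr h
    · exact Or.inl ⟨m, h', h⟩
  · rintro (⟨m, hm, h⟩ | h)
    · exact ⟨m, hm.trans n.le_succ, h⟩
    · exact ⟨n + 1, le_rfl, h⟩

lemma hitsBy_mono (c : X → T) (B : Set (X × T)) : Monotone (hitsBy c B) :=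
  fun _ _ hmn _ ⟨m, hm, h⟩ => ⟨m, hm.trans hmn, h⟩

variable [MeasurableSpace X] [MeasurableSpace T] [MeasurableAdd₂ T]

lemma measurable_pathCost {c : X → T} (hc : Measurable c) (n : ℕ) :
    Measurable fun ω => pathCost c ω n :=
  Finset.measurable_fun_sum _ fun _ _ => hc.comp (measurable_pi_apply _)

lemma measurableSet_hitsBy {c : X → T} (hc : Measurable c) {B : Set (X × T)}
    (hB : MeasurableSet B) (n : ℕ) : MeasurableSet (hitsBy c B n) := by
  have : hitsBy c B n = ⋃ m ≤ n, (fun ω : ℕ → X => (ω m, pathCost c ω m)) ⁻¹' B := by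
    ext ω
    simp [hitsBy]
  rw [this]
  exact MeasurableSet.biUnion (Set.to_countable _) fun m _ =>
    ((measurable_pi_apply m).prodMk (measurable_pathCost hc m)) hB

end History

/-! ### Subsolutions and hitting probabilities -/

namespace Policy

variable {X L T : Type*} [MeasurableSpace X] [MeasurableSpace L] {en : X → Set L}

lemma lintegral_next [Finite L] [MeasurableSingletonClass L] (D : Policy X L en)
    (step : Kernel (X × L) X) [IsMarkovKernel step] (n : ℕ) (h : Finset.Iic n → X)
    {f : X → ℝ≥0∞} (hf : Measurable f) :
    ∫⁻ y, f y ∂D.next step n h = ∫⁻ l, ∫⁻ y, f y ∂step (lastOf h, l) ∂D.choice n h := by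
  rw [next, Kernel.lintegral_comp _ _ _ hf, Kernel.lintegral_deterministic_prod]
  exact hf.lintegral_kernel

/-- A lower bound on all enabled labels is a lower bound on the choice of the policy. -/
lemma le_lintegral_next [Finite L] [MeasurableSingletonClass L] (D : Policy X L en)
    (step : Kernel (X × L) X) [IsMarkovKernel step] (n : ℕ) (h : Finset.Iic n → X)
    {f : X → ℝ≥0∞} (hf : Measurable f) {a : ℝ≥0∞}
    (ha : ∀ l ∈ en (lastOf h), a ≤ ∫⁻ y, f y ∂step (lastOf h, l)) :
    a ≤ ∫⁻ y, f y ∂D.next step n h := by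
  rw [D.lintegral_next step n h hf]
  have hae : ∀ᵐ l ∂D.choice n h, l ∈ en (lastOf h) := by
    rw [ae_iff_of_countable]
    exact fun l hl => D.enabled n h l hl
  calc a = ∫⁻ _, a ∂D.choice n h := by simp
    _ ≤ _ := lintegral_mono_ae (hae.mono fun l hl => ha l hl)

/-- This is the disintegration of the path measure at step n: the joint law of the history and the
next element is the law of the history composed with `next`. -/
lemma lintegral_pathMeasure_succ (D : Policy X L en) (step : Kernel (X × L) X)
    [IsMarkovKernel step] (x₀ : X) (n : ℕ) {f : (Finset.Iic n → X) × X → ℝ≥0∞}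
    (hf : Measurable f) :
    ∫⁻ ω, f (Preorder.frestrictLe (π := fun _ => X) n ω, ω (n + 1)) ∂D.pathMeasure step x₀ =
      ∫⁻ ω, ∫⁻ y, f (Preorder.frestrictLe (π := fun _ => X) n ω, y)
        ∂D.next step n (Preorder.frestrictLe (π := fun _ => X) n ω) ∂D.pathMeasure step x₀ := by
  have h1 := Kernel.partialTraj_compProd_eq_map_traj (X := fun _ => X) (κ := D.next step)
    (zero_le : 0 ≤ n) (x₀ := fun _ => x₀)
  have h2 := Kernel.traj_map_frestrictLe_apply (X := fun _ => X) (κ := D.next step) 0 n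
    (fun _ => x₀)
  have hm : Measurable fun ω : ℕ → X =>
      (Preorder.frestrictLe (π := fun _ => X) n ω, ω (n + 1)) := by fun_prop
  unfold pathMeasure
  rw [← lintegral_map (f := f) hf hm, ← h1, Measure.lintegral_compProd hf, ← h2,
    lintegral_map hf.lintegral_kernel_prod_right' (by fun_prop)]

lemma lintegral_pathMeasure_zero (D : Policy X L en) (step : Kernel (X × L) X)
    [IsMarkovKernel step] (x₀ : X) {f : X → ℝ≥0∞} (hf : Measurable f) :
    ∫⁻ ω, f (ω 0) ∂D.pathMeasure step x₀ = f x₀ := by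
  have h2 := Kernel.traj_map_frestrictLe_apply (X := fun _ => X) (κ := D.next step) 0 0
    (fun _ => x₀)
  have h3 : Kernel.partialTraj (X := fun _ => X) (D.next step) 0 0 (fun _ => x₀) =
      Measure.dirac (fun _ => x₀) := by
    rw [Kernel.partialTraj_self, Kernel.id_apply]
  have hg : Measurable fun h : Finset.Iic 0 → X => f (h ⟨0, by simp⟩) := by fun_prop
  unfold pathMeasure
  have : ∀ ω : ℕ → X, f (ω 0) = (fun h : Finset.Iic 0 → X => f (h ⟨0, by simp⟩))
    (Preorder.frestrictLe (π := fun _ => X) 0 ω) := fun _ => rfl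
  simp_rw [this]
  rw [← lintegral_map hg (by fun_prop), h2, h3, lintegral_dirac' _ hg]

variable [AddCommMonoid T] [MeasurableSpace T] [MeasurableAdd₂ T]

open Classical in
/-- If `W` is constant on `B` and a subsolution of the one-step equations outside of `B`, then its
initial value is a lower bound for its expected value when `B` is hit or after `n` steps. -/
theorem le_lintegral_of_subsolution (D : Policy X L en) (step : Kernel (X × L) X)
    [IsMarkovKernel step] (x₀ : X) {c : X → T} (hc : Measurable c) {B : Set (X × T)}
    (hB : MeasurableSet B) (g : ℝ≥0∞) {W : ℕ → X × T → ℝ≥0∞} (hW : ∀ i, Measurable (W i))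
    (hWB : ∀ i, ∀ z ∈ B, W i z = g) (n : ℕ)
    (hstep : ∀ i < n, ∀ h : Finset.Iic i → X, (lastOf h, pathCost c (extendPath h) i) ∉ B →
      W i (lastOf h, pathCost c (extendPath h) i) ≤
        ∫⁻ y, W (i + 1) (y, pathCost c (extendPath h) i + c y) ∂D.next step i h) :
    W 0 (x₀, 0) ≤ ∫⁻ ω, (if ω ∈ hitsBy c B n then g else W n (ω n, pathCost c ω n))
      ∂D.pathMeasure step x₀ := by
  induction n with
  | zero =>
    rw [← D.lintegral_pathMeasure_zero step x₀ (f := fun x => W 0 (x, 0)) ((hW 0).comp (by fun_prop))]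
    refine lintegral_mono fun ω => ?_
    split_ifs with h
    · obtain ⟨m, hm, h⟩ := h
      obtain rfl : m = 0 := by omega
      exact (hWB 0 _ h).le
    · exact le_rfl
  | succ n ih =>
    refine (ih fun i hi => hstep i (hi.trans n.lt_succ_self)).trans ?_
    set f : (Finset.Iic n → X) × X → ℝ≥0∞ := fun p =>
      if extendPath p.1 ∈ hitsBy c B n then g
      else W (n + 1) (p.2, pathCost c (extendPath p.1) n + c p.2) with hfdef
    have hf : Measurable f := by
      refine Measurable.ite ((measurable_extendPath.comp measurable_fst)
        (measurableSet_hitsBy hc hB n)) measurable_const ((hW _).comp ?_)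
      exact measurable_snd.prodMk (((measurable_pathCost hc n).comp
        (measurable_extendPath.comp measurable_fst)).add (hc.comp measurable_snd))
    have hcongr : ∀ ω : ℕ → X, ∀ j ≤ n,
        extendPath (Preorder.frestrictLe (π := fun _ => X) n ω) j = ω j :=
      fun ω j hj => extendPath_frestrictLe ω hj
    have h1 : ∀ ω : ℕ → X, f (Preorder.frestrictLe (π := fun _ => X) n ω, ω (n + 1)) =
        if ω ∈ hitsBy c B (n + 1) then g else W (n + 1) (ω (n + 1), pathCost c ω (n + 1)) := by
      intro ω
      simp only [hfdef, mem_hitsBy_congr c B (hcongr ω), pathCost_congr c (hcongr ω),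
        mem_hitsBy_succ, pathCost_succ]
      -- A first hit at step n + 1 needs no separate bookkeeping, since W already equals g on B.
      by_cases ha : ω ∈ hitsBy c B n
      · simp [ha]
      · by_cases hb : (ω (n + 1), pathCost c ω n + c (ω (n + 1))) ∈ B
        · simp [ha, hb, hWB _ _ hb]
        · simp [ha, hb]
    simp_rw [← h1]
    rw [D.lintegral_pathMeasure_succ step x₀ n hf]
    refine lintegral_mono fun ω => ?_
    simp only [hfdef, mem_hitsBy_congr c B (hcongr ω)]
    split_ifs with h
    · simp
    · have hl : lastOf (Preorder.frestrictLe (π := fun _ => X) n ω) = ω n := rfl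
      have := hstep n n.lt_succ_self (Preorder.frestrictLe (π := fun _ => X) n ω)
      simp only [pathCost_congr c (hcongr ω), hl] at this ⊢
      exact this fun h' => h ⟨n, le_rfl, h'⟩

/-- A lower bound for the probability of hitting `B` within `n` steps. -/
theorem le_pathMeasure_hitsBy (D : Policy X L en) (step : Kernel (X × L) X)
    [IsMarkovKernel step] (x₀ : X) {c : X → T} (hc : Measurable c) {B : Set (X × T)}
    (hB : MeasurableSet B) {W : ℕ → X × T → ℝ≥0∞} (hW : ∀ i, Measurable (W i))
    (hWB : ∀ i, ∀ z ∈ B, W i z = 1) (n : ℕ) (hn : ∀ z ∉ B, W n z = 0)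
    (hstep : ∀ i < n, ∀ h : Finset.Iic i → X, (lastOf h, pathCost c (extendPath h) i) ∉ B →
      W i (lastOf h, pathCost c (extendPath h) i) ≤
        ∫⁻ y, W (i + 1) (y, pathCost c (extendPath h) i + c y) ∂D.next step i h) :
    W 0 (x₀, 0) ≤ D.pathMeasure step x₀ (hitsBy c B n) := by
  classical
  refine (D.le_lintegral_of_subsolution step x₀ hc hB 1 hW hWB n hstep).trans ?_
  rw [← lintegral_indicator_one (measurableSet_hitsBy hc hB n)]
  refine lintegral_mono fun ω => ?_
  by_cases h : ω ∈ hitsBy c B n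
  · simp [h]
  · simp only [h, if_false]
    rw [hn]
    · exact zero_le
    · exact fun h' => h ⟨n, le_rfl, h'⟩

/-- An upper bound for the probability of ever hitting `B`. -/
theorem pathMeasure_hits_add_le [Finite L] [MeasurableSingletonClass L] (D : Policy X L en)
    (step : Kernel (X × L) X)
    [IsMarkovKernel step] (x₀ : X) {c : X → T} (hc : Measurable c) {B : Set (X × T)}
    (hB : MeasurableSet B) {W : X × T → ℝ≥0∞} (hW : Measurable W)
    (hWB : ∀ z ∈ B, W z = 0) (hW1 : ∀ z, W z ≤ 1)
    (hstep : ∀ x t, (x, t) ∉ B → ∀ l ∈ en x, W (x, t) ≤ ∫⁻ y, W (y, t + c y) ∂step (x, l)) :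
    D.pathMeasure step x₀ {ω | ∃ n, (ω n, pathCost c ω n) ∈ B} + W (x₀, 0) ≤ 1 := by
  classical
  have key : ∀ n, D.pathMeasure step x₀ (hitsBy c B n) + W (x₀, 0) ≤ 1 := by
    intro n
    have h1 := D.le_lintegral_of_subsolution step x₀ hc hB 0 (W := fun _ => W) (fun _ => hW)
      (fun _ => hWB) n (fun i _ h hh => D.le_lintegral_next step i h
        (hW.comp (measurable_id.prodMk (measurable_const.add hc))) (hstep _ _ hh))
    -- Paths that have hit contribute 0 and all others at most 1, so the expectation is at most the
    -- probability of not having hit within n steps.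
    have h2 : W (x₀, 0) ≤ D.pathMeasure step x₀ (hitsBy c B n)ᶜ := by
      refine h1.trans ?_
      rw [← lintegral_indicator_one (measurableSet_hitsBy hc hB n).compl]
      refine lintegral_mono fun ω => ?_
      by_cases h : ω ∈ hitsBy c B n
      · simp [h]
      · simp [h, hW1]
    calc _ ≤ _ + D.pathMeasure step x₀ (hitsBy c B n)ᶜ := by gcongr
      _ = 1 := prob_add_prob_compl (measurableSet_hitsBy hc hB n)
  have hU : {ω | ∃ n, (ω n, pathCost c ω n) ∈ B} = ⋃ n, hitsBy c B n := by
    ext ω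
    simp only [Set.mem_ofPred_eq, Set.mem_iUnion, hitsBy]
    exact ⟨fun ⟨n, h⟩ => ⟨n, n, le_rfl, h⟩, fun ⟨_, m, _, h⟩ => ⟨m, h⟩⟩
  -- The bound is uniform in n, so it passes to the increasing union.
  rw [hU, (hitsBy_mono c B).measure_iUnion, ENNReal.iSup_add]
  exact iSup_le key

/-- The deterministic policy that, after `n` steps, chooses a label as a measurable function of
the last element and of the accumulated cost. -/
def ofCost [MeasurableSingletonClass L] [Countable L] {c : X → T} (hc : Measurable c)
    (A : ℕ → X × T → L) (hA : ∀ n, Measurable (A n)) (hen : ∀ n x t, A n (x, t) ∈ en x) :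
    Policy X L en where
  choice n := Kernel.deterministic
    (fun h => A n (lastOf h, pathCost c (extendPath h) n))
    ((hA n).comp (measurable_lastOf.prodMk
      ((measurable_pathCost hc n).comp measurable_extendPath)))
  isMarkov _ := inferInstance
  enabled n h l hl := by
    rw [Kernel.deterministic_apply, Measure.dirac_apply] at hl
    have : A n (lastOf h, pathCost c (extendPath h) n) ∈ ({l} : Set L) := by
      by_contra h'
      exact hl (Set.indicator_of_notMem h' _)
    rw [← Set.mem_singleton_iff.1 this]
    exact hen _ _ _

lemma lintegral_next_ofCost [MeasurableSingletonClass L] [Finite L] {c : X → T}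
    (hc : Measurable c)
    (A : ℕ → X × T → L) (hA : ∀ n, Measurable (A n)) (hen : ∀ n x t, A n (x, t) ∈ en x)
    (step : Kernel (X × L) X) [IsMarkovKernel step] (n : ℕ) (h : Finset.Iic n → X)
    {f : X → ℝ≥0∞} (hf : Measurable f) :
    ∫⁻ y, f y ∂(ofCost hc A hA hen).next step n h =
      ∫⁻ y, f y ∂step (lastOf h, A n (lastOf h, pathCost c (extendPath h) n)) := by
  rw [lintegral_next _ _ _ _ hf]
  simp only [ofCost, Kernel.deterministic_apply, lintegral_dirac]

/-- The supremum over all policies of the probability of ever hitting `B` is at least the value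
of a subsolution that is attained by measurably chosen labels. -/
theorem exists_le_pathMeasure_hits [MeasurableSingletonClass L] [Finite L]
    (step : Kernel (X × L) X) [IsMarkovKernel step] (x₀ : X) {c : X → T} (hc : Measurable c)
    {B : Set (X × T)} (hB : MeasurableSet B) {W : ℕ → X × T → ℝ≥0∞}
    (hW : ∀ i, Measurable (W i)) (hWB : ∀ i, ∀ z ∈ B, W i z = 1) (h0 : ∀ z ∉ B, W 0 z = 0)
    (A : ℕ → X × T → L) (hA : ∀ n, Measurable (A n)) (hen : ∀ n x t, A n (x, t) ∈ en x)
    (hstep : ∀ i x t, (x, t) ∉ B →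
      W (i + 1) (x, t) ≤ ∫⁻ y, W i (y, t + c y) ∂step (x, A i (x, t))) (n : ℕ) :
    ∃ D : Policy X L en,
      W n (x₀, 0) ≤ D.pathMeasure step x₀ {ω | ∃ n, (ω n, pathCost c ω n) ∈ B} := by
  -- `W` and `A` are indexed by the steps still to go, hence the reversal; after step n the
  -- truncated index 0 is used, which does not affect the bound.
  refine ⟨ofCost hc (fun i => A (n - (i + 1))) (fun _ => hA _) (fun _ => hen _), ?_⟩
  have := (ofCost hc (fun i => A (n - (i + 1))) (fun _ => hA _)
    (fun _ => hen _)).le_pathMeasure_hitsBy step x₀ hc hB (W := fun i => W (n - i))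
    (fun _ => hW _) (fun _ => hWB _) n (by simpa using h0) (by
      intro i hi h hh
      have h1 := hstep (n - (i + 1)) _ _ hh
      rw [show n - (i + 1) + 1 = n - i by omega] at h1
      exact h1.trans (lintegral_next_ofCost hc _ _ _ step i h
        (f := fun y => W (n - (i + 1)) (y, pathCost c (extendPath h) i + c y))
        ((hW _).comp (measurable_id.prodMk (measurable_const.add hc)))).ge)
  exact this.trans (measure_mono fun ω ⟨m, _, h⟩ => ⟨m, h⟩)

end Policy


/-! ### Expectations under finitely supported distributions -/

namespace PMF

variable {S : Type*} [Fintype S]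

/-- The expectation of a real function under a distribution on a finite type. -/
def mean (μ : PMF S) (f : S → ℝ) : ℝ := ∑ s, (μ s).toReal * f s

lemma mean_mono (μ : PMF S) {f g : S → ℝ} (h : ∀ s, f s ≤ g s) : μ.mean f ≤ μ.mean g :=
  Finset.sum_le_sum fun s _ => mul_le_mul_of_nonneg_left (h s) ENNReal.toReal_nonneg

lemma sum_toReal (μ : PMF S) : ∑ s, (μ s).toReal = 1 := by
  rw [← ENNReal.toReal_sum fun s _ => μ.apply_ne_top s, ← tsum_fintype (L := .unconditional _),
    μ.tsum_coe, ENNReal.toReal_one]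

lemma mean_const (μ : PMF S) (a : ℝ) : μ.mean (fun _ => a) = a := by
  rw [mean, ← Finset.sum_mul, μ.sum_toReal, one_mul]

lemma mean_nonneg (μ : PMF S) {f : S → ℝ} (h : ∀ s, 0 ≤ f s) : 0 ≤ μ.mean f :=
  Finset.sum_nonneg fun s _ => mul_nonneg ENNReal.toReal_nonneg (h s)

lemma mean_le (μ : PMF S) {f : S → ℝ} {a : ℝ} (h : ∀ s, f s ≤ a) : μ.mean f ≤ a :=
  (μ.mean_mono h).trans_eq (μ.mean_const a)

lemma mean_const_mul (μ : PMF S) (a : ℝ) (f : S → ℝ) :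
    μ.mean (fun s => a * f s) = a * μ.mean f := by
  simp only [mean, Finset.mul_sum]
  exact Finset.sum_congr rfl fun _ _ => by ring

lemma mean_const_sub (μ : PMF S) (a : ℝ) (f : S → ℝ) :
    μ.mean (fun s => a - f s) = a - μ.mean f := by
  simp only [mean, mul_sub, Finset.sum_sub_distrib, ← Finset.sum_mul, μ.sum_toReal, one_mul]

variable [MeasurableSpace S] [DiscreteMeasurableSpace S]

lemma lintegral_toMeasure (μ : PMF S) (f : S → ℝ≥0∞) :
    ∫⁻ s, f s ∂μ.toMeasure = ∑ s, μ s * f s := by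
  rw [lintegral_fintype]
  exact Finset.sum_congr rfl fun s _ => by
    rw [μ.toMeasure_apply_singleton s (measurableSet_singleton s), mul_comm]

lemma lintegral_ofReal (μ : PMF S) {f : S → ℝ} (hf : ∀ s, 0 ≤ f s) :
    ∫⁻ s, ENNReal.ofReal (f s) ∂μ.toMeasure = ENNReal.ofReal (μ.mean f) := by
  rw [μ.lintegral_toMeasure, mean,
    ENNReal.ofReal_sum_of_nonneg fun s _ => mul_nonneg ENNReal.toReal_nonneg (hf s)]
  exact Finset.sum_congr rfl fun s _ => by
    rw [ENNReal.ofReal_mul ENNReal.toReal_nonneg, ENNReal.ofReal_toReal (μ.apply_ne_top s)]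

end PMF

/-! ### Values of discretised Markov automata -/

namespace DiscretisedMA

variable {S Act : Type*} (N : DiscretisedMA S Act)

/-- The distribution of the next state when a label is chosen. -/
def law (s : S) : StepLabel Act → PMF S
  | .act α => (N.prob s α).getD (PMF.pure s)
  | .bot => (N.tick s).getD (PMF.pure s)

variable [Fintype S]

open Classical in
/-- The maximal probability of reaching `G` within `n` transitions and `k` time steps. -/
def value (G : Set S) : ℕ → ℕ → S → ℝ
  | 0, _, s => if s ∈ G then 1 else 0
  | n + 1, k, s => if s ∈ G then 1 else ⨆ l : N.enabled s,
      if l.1.ticks ≤ k then (N.law s l).mean (value G n (k - l.1.ticks)) else 0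

/-- The maximal probability of reaching `G` within `k` time steps, as the limit of the
probabilities of reaching it within a bounded number of transitions. -/
def limValue (G : Set S) (k : ℕ) (s : S) : ℝ := ⨆ n, N.value G n k s

variable {N} {G : Set S}

lemma value_of_mem {s : S} (hs : s ∈ G) (n k : ℕ) : N.value G n k s = 1 := by
  cases n <;> simp [value, hs]

lemma value_zero_of_notMem {s : S} (hs : s ∉ G) (k : ℕ) : N.value G 0 k s = 0 := by
  simp [value, hs]

lemma value_mem_Icc (n k : ℕ) (s : S) : N.value G n k s ∈ Set.Icc 0 1 := by
  induction n generalizing k s with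
  | zero => unfold value; split_ifs <;> simp
  | succ n ih =>
    unfold value
    split_ifs
    · simp
    · constructor
      · refine Real.iSup_nonneg fun l => ?_
        split_ifs
        · exact PMF.mean_nonneg _ fun t => (ih _ t).1
        · exact le_rfl
      · refine Real.iSup_le (fun l => ?_) zero_le_one
        split_ifs
        · exact PMF.mean_le _ fun t => (ih _ t).2
        · exact zero_le_one

lemma value_nonneg (n k : ℕ) (s : S) : 0 ≤ N.value G n k s := (value_mem_Icc n k s).1

lemma value_le_one (n k : ℕ) (s : S) : N.value G n k s ≤ 1 := (value_mem_Icc n k s).2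

lemma bddAbove_range_value (k : ℕ) (s : S) : BddAbove (Set.range fun n => N.value G n k s) :=
  ⟨1, by rintro _ ⟨n, rfl⟩; exact value_le_one n k s⟩

lemma value_le_limValue (n k : ℕ) (s : S) : N.value G n k s ≤ N.limValue G k s :=
  le_ciSup (bddAbove_range_value k s) n

lemma limValue_nonneg (k : ℕ) (s : S) : 0 ≤ N.limValue G k s :=
  (value_nonneg 0 k s).trans (value_le_limValue 0 k s)

lemma limValue_le_one (k : ℕ) (s : S) : N.limValue G k s ≤ 1 :=
  ciSup_le fun n => value_le_one n k s

lemma limValue_of_mem {s : S} (hs : s ∈ G) (k : ℕ) : N.limValue G k s = 1 :=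
  (limValue_le_one k s).antisymm ((value_of_mem hs 0 k).symm.le.trans (value_le_limValue 0 k s))

variable [Finite Act]

lemma mean_le_value_succ {s : S} {l : StepLabel Act} (hl : l ∈ N.enabled s) (n k : ℕ)
    (hk : l.ticks ≤ k) : (N.law s l).mean (N.value G n (k - l.ticks)) ≤ N.value G (n + 1) k s := by
  by_cases hs : s ∈ G
  · rw [value_of_mem hs]
    exact PMF.mean_le _ fun t => value_le_one _ _ t
  · simp only [value, hs, if_false]
    refine le_trans ?_ (le_ciSup (Set.finite_range _).bddAbove ⟨l, hl⟩)
    simp [hk]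

/-- There are finitely many labels, so the supremum is attained; the maximisers define the policies
below. -/
lemma exists_value_succ_eq {s : S} (hs : s ∉ G) (hen : (N.enabled s).Nonempty) (n k : ℕ) :
    ∃ l ∈ N.enabled s, N.value G (n + 1) k s =
      if l.ticks ≤ k then (N.law s l).mean (N.value G n (k - l.ticks)) else 0 := by
  have : Nonempty (N.enabled s) := hen.to_subtype
  obtain ⟨l, hl⟩ := exists_eq_ciSup_of_finite (f := fun l : N.enabled s =>
    if l.1.ticks ≤ k then (N.law s l).mean (N.value G n (k - l.1.ticks)) else 0)
  refine ⟨l.1, l.2, ?_⟩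
  rw [value, if_neg hs, ← hl]

lemma value_mono_left (k : ℕ) (s : S) : Monotone fun n => N.value G n k s := by
  refine monotone_nat_of_le_succ fun n => ?_
  induction n generalizing k s with
  | zero =>
    by_cases hs : s ∈ G
    · simp only [value_of_mem hs, le_rfl]
    · rw [value_zero_of_notMem hs]
      exact value_nonneg _ _ _
  | succ n ih =>
    by_cases hs : s ∈ G
    · simp only [value_of_mem hs, le_rfl]
    · rw [value, value, if_neg hs, if_neg hs]
      refine ciSup_mono (Set.finite_range _).bddAbove fun l => ?_
      split_ifs
      · exact PMF.mean_mono _ fun t => ih _ t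
      · exact le_rfl

lemma value_mono_right (n : ℕ) (s : S) : Monotone fun k => N.value G n k s := by
  intro k k' hk
  induction n generalizing k k' s with
  | zero => simp [value]
  | succ n ih =>
    by_cases hs : s ∈ G
    · simp only [value_of_mem hs, le_rfl]
    · simp only [value, hs, if_false]
      refine ciSup_mono (Set.finite_range _).bddAbove fun l => ?_
      split_ifs with h1 h2
      · exact PMF.mean_mono _ fun t => ih _ (Nat.sub_le_sub_right hk _)
      · exact absurd (h1.trans hk) h2
      · exact PMF.mean_nonneg _ fun t => value_nonneg _ _ t
      · exact le_rfl

/-- The values increase with the number of transitions, and a finite mean commutes with the limit.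
This half of the Bellman equation is all that the upper bounds need. -/
lemma mean_limValue_le {s : S} {l : StepLabel Act} (hl : l ∈ N.enabled s) {k : ℕ}
    (hk : l.ticks ≤ k) : (N.law s l).mean (N.limValue G (k - l.ticks)) ≤ N.limValue G k s := by
  have h : Filter.Tendsto (fun n => (N.law s l).mean (N.value G n (k - l.ticks))) Filter.atTop
      (nhds ((N.law s l).mean (N.limValue G (k - l.ticks)))) :=
    tendsto_finsetSum _ fun t _ => (tendsto_atTop_ciSup (value_mono_left _ t)
      (bddAbove_range_value _ t)).const_mul _
  exact le_of_tendsto' h fun n =>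
    (mean_le_value_succ hl n k hk).trans (value_le_limValue (n + 1) k s)

variable [MeasurableSpace S] [DiscreteMeasurableSpace S]

lemma lintegral_stepKernel (x : Elem S Act) (l : StepLabel Act) (f : Elem S Act → ℝ≥0∞) :
    ∫⁻ y, f y ∂N.stepKernel (x, l) = ∫⁻ t, f (l, t) ∂(N.law x.2 l).toMeasure := by
  have h : N.stepKernel (x, l) = (N.law x.2 l).toMeasure.map (fun t => (l, t)) := by
    change N.stepMeasure x.2 l = _
    -- For a label that is not enabled, the default `PMF.pure` in `law` matches the Dirac measure in
    -- `stepMeasure`, so the formula holds for every label.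
    have hp : (PMF.pure x.2).toMeasure.map (fun t => (l, t)) = Measure.dirac (l, x.2) := by
      rw [PMF.toMeasure_pure, Measure.map_dirac' (by fun_prop)]
    cases l with
    | act α =>
      simp only [stepMeasure, law]
      cases N.prob x.2 α <;> simp [hp]
    | bot =>
      simp only [stepMeasure, law]
      cases N.tick x.2 <;> simp [hp]
  rw [h, lintegral_map .of_discrete .of_discrete]

end DiscretisedMA

/-! ### Maximal reachability of a discretised automaton is its limit value -/

namespace DiscretisedMA

variable {S Act : Type*}

/-- The elements and numbers of time steps taken at which `G` has been reached in time. -/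
def target (Act : Type*) (G : Set S) (k : ℕ) :
    Set (Elem S Act × ℕ) := {z | z.1.2 ∈ G ∧ z.2 ≤ k}

lemma reach_eq (G : Set S) (k : ℕ) : reach (Act := Act) k G =
    {ω | ∃ n, (ω n, pathCost (fun y => y.1.ticks) ω n) ∈ target Act G k} := rfl

variable {N : DiscretisedMA S Act} {G : Set S} [Fintype S] [Finite Act] [MeasurableSpace S]
  [DiscreteMeasurableSpace S]

/-- One minus the limit value of the remaining steps, set to 1 once the budget is exceeded, is a
subsolution vanishing on the target, whatever labels the policy chooses. -/
theorem pathMeasure_reach_le (D : N.TAPolicy) (k : ℕ) (s : S) :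
    N.pathMeasure D s (reach k G) ≤ ENNReal.ofReal (N.limValue G k s) := by
  set W : Elem S Act × ℕ → ℝ≥0∞ := fun z =>
    if z.2 ≤ k then ENNReal.ofReal (1 - N.limValue G (k - z.2) z.1.2) else 1 with hW
  have h := Policy.pathMeasure_hits_add_le D N.stepKernel (.bot, s)
    (c := fun y : Elem S Act => y.1.ticks) .of_discrete (B := target Act G k) .of_discrete
    (W := W) .of_discrete (by
      rintro ⟨x, t⟩ ⟨hx, ht⟩
      simp only [hW]
      rw [if_pos ht, limValue_of_mem hx, sub_self, ENNReal.ofReal_zero]) (by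
      rintro ⟨x, t⟩
      simp only [hW]
      split_ifs
      · rw [ENNReal.ofReal_le_one]
        linarith [limValue_nonneg (N := N) (G := G) (k - t) x.2]
      · exact le_rfl) (by
      intro x t hxt l hl
      rw [lintegral_stepKernel]
      simp only [hW]
      by_cases hk : t + l.ticks ≤ k
      · have ht : t ≤ k := (Nat.le_add_right _ _).trans hk
        simp only [hk, ht, if_true]
        rw [PMF.lintegral_ofReal _ fun s => sub_nonneg.2 (limValue_le_one _ s),
          PMF.mean_const_sub, Nat.sub_add_eq]
        gcongr
        exact mean_limValue_le hl (by omega)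
      · simp only [hk, if_false, lintegral_one, measure_univ]
        split_ifs
        · rw [ENNReal.ofReal_le_one]
          linarith [limValue_nonneg (N := N) (G := G) (k - t) x.2]
        · exact le_rfl)
  simp only [hW, zero_le, if_true, Nat.sub_zero] at h
  rw [← reach_eq] at h
  change N.pathMeasure D s (reach k G) + _ ≤ 1 at h
  have h1 : (1 : ℝ≥0∞) = ENNReal.ofReal (N.limValue G k s) +
      ENNReal.ofReal (1 - N.limValue G k s) := by
    rw [← ENNReal.ofReal_add (limValue_nonneg k s) (sub_nonneg.2 (limValue_le_one k s))]
    simp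
  rw [h1] at h
  exact (ENNReal.add_le_add_iff_right ENNReal.ofReal_ne_top).1 h

/-- The policy picks the maximiser in the recursion for the number of transitions and of time steps
still available. -/
theorem exists_value_le_pathMeasure_reach (hen : ∀ s, (N.enabled s).Nonempty) (n k : ℕ) (s : S) :
    ∃ D : N.TAPolicy, ENNReal.ofReal (N.value G n k s) ≤ N.pathMeasure D s (reach k G) := by
  classical
  have hA : ∀ n k s, ∃ l ∈ N.enabled s, s ∉ G → N.value G (n + 1) k s =
      if l.ticks ≤ k then (N.law s l).mean (N.value G n (k - l.ticks)) else 0 := by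
    intro n k s
    by_cases hs : s ∈ G
    · exact ⟨_, (hen s).some_mem, fun h => absurd hs h⟩
    · obtain ⟨l, hl, h⟩ := exists_value_succ_eq hs (hen s) n k
      exact ⟨l, hl, fun _ => h⟩
  choose A hAen hA using hA
  set W : ℕ → Elem S Act × ℕ → ℝ≥0∞ := fun n z =>
    if z.2 ≤ k then ENNReal.ofReal (N.value G n (k - z.2) z.1.2) else 0 with hW
  obtain ⟨D, hD⟩ := Policy.exists_le_pathMeasure_hits (en := fun x => N.enabled x.2)
    N.stepKernel (.bot, s)
    (c := fun y : Elem S Act => y.1.ticks) .of_discrete (B := target Act G k) .of_discrete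
    (W := W) (fun _ => .of_discrete) (by
      rintro i ⟨x, t⟩ ⟨hx, ht⟩
      simp only [hW]
      rw [if_pos ht, value_of_mem hx, ENNReal.ofReal_one]) (by
      rintro ⟨x, t⟩ hxt
      simp only [hW]
      split_ifs with ht
      · rw [value_zero_of_notMem fun hx => hxt ⟨hx, ht⟩, ENNReal.ofReal_zero]
      · rfl) (fun n z => A n (k - z.2) z.1.2) (fun _ => .of_discrete)
      (fun n x t => hAen _ _ _) (by
      intro i x t hxt
      simp only [hW]
      split_ifs with ht
      · rw [hA _ _ _ fun hx => hxt ⟨hx, ht⟩, lintegral_stepKernel]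
        split_ifs with hl
        · have hl' : t + (A i (k - t) x.2).ticks ≤ k := by
            rw [add_comm]
            exact Nat.add_le_of_le_sub ht hl
          simp only [hl', if_true]
          rw [PMF.lintegral_ofReal _ fun s => value_nonneg _ _ s, Nat.sub_add_eq]
        · simp
      · exact zero_le) n
  refine ⟨D, ?_⟩
  simpa only [hW, zero_le, if_true, Nat.sub_zero] using! hD

lemma limValue_le_pmax (hen : ∀ s, (N.enabled s).Nonempty) (k : ℕ)
    (s : S) : N.limValue G k s ≤ N.pmax s k G := by
  refine ciSup_le fun n => ?_
  obtain ⟨D, hD⟩ := exists_value_le_pathMeasure_reach (G := G) hen n k s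
  refine (ENNReal.ofReal_le_iff_le_toReal ?_).1
    (hD.trans (le_iSup (fun D : N.TAPolicy => N.pathMeasure D s (reach k G)) D))
  refine ne_top_of_le_ne_top ENNReal.ofReal_ne_top
    (iSup_le fun D => pathMeasure_reach_le D k s)

lemma pmax_le_limValue (k : ℕ) (s : S) :
    N.pmax s k G ≤ N.limValue G k s :=
  ENNReal.toReal_le_of_le_ofReal (limValue_nonneg k s)
    (iSup_le fun D => pathMeasure_reach_le D k s)

end DiscretisedMA


/-! ### The exponential distribution -/

lemma lintegral_expMeasure (r : ℝ) {f : ℝ → ℝ≥0∞} (hf : Measurable f) :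
    ∫⁻ t, f t ∂expMeasure r = ∫⁻ t, exponentialPDF r t * f t :=
  lintegral_withDensity_eq_lintegral_mul _ (measurable_exponentialPDFReal r).ennreal_ofReal hf

lemma ae_expMeasure_pos (r : ℝ) : ∀ᵐ t ∂expMeasure r, 0 < t := by
  change ∀ᵐ t ∂(volume.withDensity (exponentialPDF r)), 0 < t
  rw [ae_withDensity_iff (f := exponentialPDF r) (measurable_exponentialPDFReal r).ennreal_ofReal]
  filter_upwards [Measure.ae_ne volume (0 : ℝ)] with t ht h
  by_contra h'
  exact h (exponentialPDF_of_neg (lt_of_le_of_ne (not_lt.1 h') ht))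

/-- The exponential distribution is memoryless. -/
lemma lintegral_expMeasure_eq_add (r : ℝ) {f : ℝ → ℝ≥0∞} (hf : Measurable f) {c : ℝ}
    (hc : 0 ≤ c) :
    ∫⁻ t, f t ∂expMeasure r = ∫⁻ t in Set.Iio c, f t ∂expMeasure r +
      ENNReal.ofReal (Real.exp (-(r * c))) * ∫⁻ t, f (t + c) ∂expMeasure r := by
  rw [← lintegral_add_compl f (measurableSet_Iio (a := c))]
  congr 1
  have hfc : Measurable fun t => f (t + c) := by fun_prop
  rw [lintegral_expMeasure r hfc, ← lintegral_const_mul, ← lintegral_indicator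
    measurableSet_Iio.compl, lintegral_expMeasure r (hf.indicator measurableSet_Iio.compl),
    ← lintegral_add_right_eq_self _ c]
  · refine lintegral_congr fun t => ?_
    rcases lt_or_ge t 0 with ht | ht
    · simp [exponentialPDF_of_neg ht, ht]
    · have : t + c ∈ (Set.Iio c)ᶜ := by simp [ht]
      rw [Set.indicator_of_mem this, exponentialPDF_of_nonneg ht,
        exponentialPDF_of_nonneg (add_nonneg ht hc), ← mul_assoc,
        ← ENNReal.ofReal_mul (Real.exp_pos _).le]
      congr 2
      rw [mul_add, neg_add, Real.exp_add]
      ring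
  · exact (measurable_exponentialPDFReal r).ennreal_ofReal.mul hfc

lemma expMeasure_Iio {r : ℝ} (hr : 0 < r) {c : ℝ} (hc : 0 ≤ c) :
    expMeasure r (Set.Iio c) = ENNReal.ofReal (1 - Real.exp (-(r * c))) := by
  have := isProbabilityMeasure_expMeasure hr
  have h := lintegral_expMeasure_eq_add r (f := fun _ => 1) measurable_const hc
  simp only [lintegral_const, measure_univ, mul_one, one_mul, Measure.restrict_apply,
    MeasurableSet.univ, Set.univ_inter] at h
  rw [ENNReal.ofReal_sub _ (Real.exp_pos _).le, ENNReal.ofReal_one, h,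
    ENNReal.add_sub_cancel_right ENNReal.ofReal_ne_top]

/-- The integral is the probability that an event of rate r occurs before c and then none of rate
lam until c. On [0, c) the integrand against Lebesgue measure is r e^{-rt} e^{-lam(c-t)} ≥ r e^{-lam
c}, because r ≤ lam. -/
lemma le_setLIntegral_expMeasure {r lam c : ℝ} (hr : 0 < r) (hlam : r ≤ lam) :
    ENNReal.ofReal (Real.exp (-(lam * c)) * (r * c)) ≤
      ∫⁻ t in Set.Iio c, ENNReal.ofReal (Real.exp (-(lam * (c - t)))) ∂expMeasure r := by
  have hm : Measurable fun t => ENNReal.ofReal (Real.exp (-(lam * (c - t)))) := by fun_prop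
  rw [← lintegral_indicator measurableSet_Iio,
    lintegral_expMeasure r (hm.indicator measurableSet_Iio)]
  calc ENNReal.ofReal (Real.exp (-(lam * c)) * (r * c))
      = ∫⁻ t in Set.Ico 0 c, ENNReal.ofReal (Real.exp (-(lam * c)) * r) := by
        rw [lintegral_const, Measure.restrict_apply MeasurableSet.univ, Set.univ_inter,
          Real.volume_Ico, sub_zero, ← ENNReal.ofReal_mul (by positivity), mul_assoc]
    _ = ∫⁻ t, (Set.Ico 0 c).indicator
          (fun _ => ENNReal.ofReal (Real.exp (-(lam * c)) * r)) t := by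
        rw [lintegral_indicator measurableSet_Ico]
    _ ≤ _ := by
        refine lintegral_mono fun t => ?_
        by_cases ht : t ∈ Set.Ico 0 c
        · have ht' : t ∈ Set.Iio c := ht.2
          rw [Set.indicator_of_mem ht, Set.indicator_of_mem ht', exponentialPDF_of_nonneg ht.1,
            ← ENNReal.ofReal_mul (by positivity)]
          refine ENNReal.ofReal_le_ofReal ?_
          rw [mul_comm, mul_assoc, ← Real.exp_add]
          gcongr
          nlinarith [ht.1]
        · rw [Set.indicator_of_notMem ht]
          exact zero_le

/-! ### Timed reachability and values of the discretised automaton -/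

namespace MarkovAutomaton

variable {S Act : Type*} {M : MarkovAutomaton S Act} {s : S}

lemma enabled_nonempty : (M.enabled s).Nonempty := by
  by_cases hs : s ∈ M.MS
  · exact ⟨.bot, hs⟩
  · obtain ⟨α, μ, h⟩ := not_not.1 hs
    exact ⟨.act α, μ, h⟩

lemma eq_bot_of_enabled (hs : s ∈ M.MS) {l : StepLabel Act} (hl : l ∈ M.enabled s) :
    l = .bot := by
  cases l with
  | act α => exact absurd ⟨α, hl⟩ hs
  | bot => rfl

variable [Fintype S] {δ : ℝ} {hδ : 0 < δ}

lemma enabled_discretise : (M.discretise δ hδ).enabled s = M.enabled s := by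
  ext l
  cases l with
  | act α => rfl
  | bot =>
    change (∃ μ, (M.discretise δ hδ).tick s = some μ) ↔ s ∈ M.MS
    by_cases hs : s ∈ M.MS <;> simp [discretise, hs]

/-- A tick is a mixture of a jump by `branch` and staying put; in this form it can be matched term
by term with `jump_eq_add` at c = δ. -/
lemma mean_law_bot (hs : s ∈ M.MS) (f : S → ℝ) :
    ((M.discretise δ hδ).law s .bot).mean f =
      (1 - Real.exp (-(M.exitRate s * δ))) * (M.branch s hs).mean f +
        Real.exp (-(M.exitRate s * δ)) * f s := by
  classical
  have hE := M.exitRate_pos hs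
  have h1 : 0 ≤ 1 - Real.exp (-(M.exitRate s * δ)) :=
    sub_nonneg.2 (Real.exp_le_one_iff.2 (neg_nonpos.2 (mul_pos hE hδ).le))
  have h2 : ∀ t, 0 ≤ M.rate s t / M.exitRate s := fun t => div_nonneg (M.rate_nonneg s t) hE.le
  have hlaw : (M.discretise δ hδ).law s .bot = M.tickDist δ hδ s hs := by
    simp [DiscretisedMA.law, discretise, hs]
  have hterm : ∀ t, (M.tickDist δ hδ s hs t).toReal * f t =
      (1 - Real.exp (-(M.exitRate s * δ))) * ((M.branch s hs t).toReal * f t) +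
        if t = s then Real.exp (-(M.exitRate s * δ)) * f s else 0 := by
    intro t
    simp only [tickDist, branch, PMF.ofFintype_apply]
    rw [ENNReal.toReal_ofReal (h2 t), ENNReal.toReal_ofReal]
    · split_ifs with h
      · rw [h]; ring
      · ring
    · have := mul_nonneg h1 (h2 t)
      split_ifs <;> positivity
  rw [hlaw, PMF.mean, PMF.mean, Finset.mul_sum]
  simp only [hterm, Finset.sum_add_distrib, Finset.sum_ite_eq', Finset.mem_univ, if_true]

variable [MeasurableSpace S] [DiscreteMeasurableSpace S]

/-- The expectation of `F` at the remaining time and the next state when a Markovian state is left,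
if the remaining time is `r`. -/
def jump (s : S) (hs : s ∈ M.MS) (F : ℝ → S → ℝ≥0∞) (r : ℝ) : ℝ≥0∞ :=
  ∫⁻ t, ∫⁻ s', F (r - t) s' ∂(M.branch s hs).toMeasure ∂expMeasure (M.exitRate s)

lemma measurable_lintegral_branch (μ : PMF S) {F : ℝ → S → ℝ≥0∞}
    (hF : ∀ s, Measurable fun r => F r s) (r : ℝ) :
    Measurable fun t => ∫⁻ s', F (r - t) s' ∂μ.toMeasure := by
  simp only [PMF.lintegral_toMeasure]
  exact Finset.measurable_fun_sum _ fun s _ =>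
    ((hF s).comp (measurable_const.sub measurable_id)).const_mul _

/-- By memorylessness, surviving c time units without a jump leaves the same problem with remaining
time r - c. -/
lemma jump_eq_add (hs : s ∈ M.MS) {F : ℝ → S → ℝ≥0∞} (hF : ∀ s, Measurable fun r => F r s)
    (r : ℝ) {c : ℝ} (hc : 0 ≤ c) :
    jump s hs F r = ∫⁻ t in Set.Iio c, ∫⁻ s', F (r - t) s' ∂(M.branch s hs).toMeasure
        ∂expMeasure (M.exitRate s) +
      ENNReal.ofReal (Real.exp (-(M.exitRate s * c))) * jump s hs F (r - c) := by
  rw [jump, lintegral_expMeasure_eq_add _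
    (measurable_lintegral_branch _ hF r) hc]
  simp only [jump, sub_sub, add_comm c]

variable [Finite Act]

lemma lintegral_stepKernel_bot (x : Elem S Act) (hs : x.2.2 ∈ M.MS) {F : ℝ → S → ℝ≥0∞}
    (hF : ∀ s, Measurable fun r => F r s) (b e : ℝ) :
    ∫⁻ y, F (b - (e + y.2.1)) y.2.2 ∂M.stepKernel (x, .bot) = jump x.2.2 hs F (b - e) := by
  have hm : Measurable fun y : Elem S Act => F (b - (e + y.2.1)) y.2.2 := by
    have h : Measurable fun p : ℝ × S => F p.1 p.2 := measurable_from_prod_countable_left hF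
    exact h.comp ((measurable_const.sub (measurable_const.add (by fun_prop))).prodMk (by fun_prop))
  have := isProbabilityMeasure_expMeasure (M.exitRate_pos hs)
  have : IsProbabilityMeasure ((expMeasure (M.exitRate x.2.2)).map Real.toNNReal) :=
    Measure.isProbabilityMeasure_map measurable_real_toNNReal.aemeasurable
  have hk : M.stepKernel (x, .bot) = (((expMeasure (M.exitRate x.2.2)).map Real.toNNReal).prod
      (M.branch x.2.2 hs).toMeasure).map (fun p => (.bot, p.1, p.2)) := by
    change M.stepMeasure x.2.2 .bot = _
    rw [stepMeasure, dif_pos hs]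
  have hm2 : Measurable fun p : ℝ≥0 × S => ((.bot, p.1, p.2) : Elem S Act) := by fun_prop
  have hm3 : Measurable fun p : ℝ≥0 × S => F (b - (e + p.1)) p.2 := hm.comp hm2
  rw [hk, lintegral_map hm hm2, lintegral_prod _ hm3.aemeasurable,
    lintegral_map hm3.lintegral_prod_right' measurable_real_toNNReal]
  -- Residence times are almost surely positive, so truncation by `Real.toNNReal` changes nothing.
  refine lintegral_congr_ae ((ae_expMeasure_pos _).mono fun t ht => ?_)
  simp only [Real.coe_toNNReal _ ht.le, sub_sub]

lemma lintegral_stepKernel_act (x : Elem S Act) (α : Act) (F : ℝ → S → ℝ≥0∞)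
    (hF : ∀ s, Measurable fun r => F r s) (b e : ℝ) :
    ∫⁻ y, F (b - (e + y.2.1)) y.2.2 ∂M.stepKernel (x, .act α) =
      ∫⁻ s', F (b - e) s' ∂((M.discretise δ hδ).law x.2.2 (.act α)).toMeasure := by
  have hm : Measurable fun y : Elem S Act => F (b - (e + y.2.1)) y.2.2 := by
    have h : Measurable fun p : ℝ × S => F p.1 p.2 := measurable_from_prod_countable_left hF
    exact h.comp ((measurable_const.sub (measurable_const.add (by fun_prop))).prodMk (by fun_prop))
  have hk : M.stepKernel (x, .act α) =
      ((M.discretise δ hδ).law x.2.2 (.act α)).toMeasure.map (fun s' => (.act α, 0, s')) := by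
    change M.stepMeasure x.2.2 (.act α) = _
    simp only [stepMeasure, DiscretisedMA.law, discretise]
    cases M.prob x.2.2 α
    · rw [Option.getD_none, PMF.toMeasure_pure, Measure.map_dirac' (by fun_prop)]
    · rfl
  rw [hk, lintegral_map hm (by fun_prop)]
  simp

/-- The elements and elapsed times at which `G` has been reached in time. -/
def target (Act : Type*) (G : Set S) (b : ℝ) : Set (Elem S Act × ℝ) :=
  {z | z.1.2.2 ∈ G ∧ z.2 ≤ b}

end MarkovAutomaton


/-! ### Lower bound: following the discretised automaton in continuous time -/

namespace MarkovAutomaton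

variable {S Act : Type*} {G : Set S}

lemma elapsed_le_succ (ω : ℕ → Elem S Act) (n : ℕ) : elapsed ω n ≤ elapsed ω (n + 1) := by
  unfold elapsed
  rw [Finset.sum_range_succ]
  exact le_add_of_nonneg_right NNReal.zero_le_coe

lemma measurableSet_target [MeasurableSpace S] [DiscreteMeasurableSpace S] (b : ℝ) :
    MeasurableSet (target Act G b) :=
  (show Measurable fun z : Elem S Act × ℝ => z.1.2.2 by fun_prop) (.of_discrete (s := G)) |>.inter
    (measurableSet_le measurable_snd measurable_const)

/-- A state occupied by time b was entered by time b. Conversely the entry time belongs to the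
closed occupation interval, so states that are left at once count as well. -/
lemma reach_Icc_eq (b : ℝ) : reach (Act := Act) (Set.Icc 0 b) G =
    {ω | ∃ n, (ω n, pathCost (fun y : Elem S Act => (y.2.1 : ℝ)) ω n) ∈ target Act G b} := by
  ext ω
  constructor
  · rintro ⟨t, ht, s, ⟨n, rfl, h1, h2⟩, hs⟩
    exact ⟨n, hs, h1.trans ht.2⟩
  · rintro ⟨n, hs, h⟩
    exact ⟨elapsed ω n, ⟨Finset.sum_nonneg fun _ _ => NNReal.zero_le_coe, h⟩, _,
      ⟨n, rfl, le_rfl, elapsed_le_succ ω n⟩, hs⟩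

lemma measurable_floor_div {β : Type*} [MeasurableSpace β] (δ : ℝ) (f : ℕ → β) :
    Measurable fun r : ℝ => f ⌊r / δ⌋₊ :=
  (Measurable.of_discrete (f := f)).comp (Nat.measurable_floor.comp (measurable_id.div_const δ))

variable [Fintype S] {δ : ℝ}

/-- The value of the discretised automaton at the integral part of the remaining time. -/
def floorValue (N : DiscretisedMA S Act) (δ : ℝ) (G : Set S) (n : ℕ) (r : ℝ) (s : S) : ℝ≥0∞ :=
  if 0 ≤ r then ENNReal.ofReal (N.value G n ⌊r / δ⌋₊ s) else 0

lemma measurable_floorValue (N : DiscretisedMA S Act) (n : ℕ) (s : S) :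
    Measurable fun r => floorValue N δ G n r s :=
  Measurable.ite measurableSet_Ici
    (measurable_floor_div δ fun k => ENNReal.ofReal (N.value G n k s)) measurable_const

variable [MeasurableSpace S] [DiscreteMeasurableSpace S]

lemma measurable_remaining {β : Type*} [MeasurableSpace β] {F : ℝ → S → β}
    (hF : ∀ s, Measurable fun r => F r s) (b : ℝ) :
    Measurable fun z : Elem S Act × ℝ => F (b - z.2) z.1.2.2 := by
  have h : Measurable fun p : ℝ × S => F p.1 p.2 := measurable_from_prod_countable_left hF
  exact h.comp ((measurable_const.sub measurable_snd).prodMk (by fun_prop))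

variable [Finite Act] {M : MarkovAutomaton S Act} {hδ : 0 < δ} {s : S}

/-- Split the residence time at δ. A jump before δ leaves at least k - 1 full steps, as many as the
tick grants; otherwise the residence restarts with one step fewer, and induction on k applies. -/
lemma value_le_jump (hs : s ∈ M.MS) (hsG : s ∉ G) (n k : ℕ) {r : ℝ} (hr : k * δ ≤ r) :
    ENNReal.ofReal ((M.discretise δ hδ).value G (n + 1) k s) ≤
      jump s hs (floorValue (M.discretise δ hδ) δ G n) r := by
  set N := M.discretise δ hδ with hN
  have hval : ∀ k, N.value G (n + 1) k s =
      if 1 ≤ k then (N.law s .bot).mean (N.value G n (k - 1)) else 0 := by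
    intro k
    obtain ⟨l, hl, h⟩ := DiscretisedMA.exists_value_succ_eq (N := N) hsG
      (by rw [enabled_discretise]; exact enabled_nonempty) n k
    rw [enabled_discretise] at hl
    obtain rfl := eq_bot_of_enabled hs hl
    exact h
  induction k generalizing r with
  | zero => simp [hval]
  | succ k ih =>
    push_cast at hr
    have hE := M.exitRate_pos hs
    have hexp : 0 ≤ 1 - Real.exp (-(M.exitRate s * δ)) :=
      sub_nonneg.2 (Real.exp_le_one_iff.2 (neg_nonpos.2 (mul_pos hE hδ).le))
    have hmean : 0 ≤ (M.branch s hs).mean (N.value G n k) :=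
      PMF.mean_nonneg _ fun _ => DiscretisedMA.value_nonneg _ _ _
    have hnn := DiscretisedMA.value_nonneg (N := N) (G := G) n k s
    rw [hval, if_pos (by omega), mean_law_bot hs, Nat.add_sub_cancel,
      ENNReal.ofReal_add (mul_nonneg hexp hmean) (by positivity),
      jump_eq_add hs (measurable_floorValue N n) r hδ.le]
    refine add_le_add ?_ ?_
    · rw [ENNReal.ofReal_mul hexp, ← expMeasure_Iio hE hδ.le, mul_comm, ← setLIntegral_const]
      refine setLIntegral_mono' measurableSet_Iio fun t ht => ?_
      rw [← PMF.lintegral_ofReal _ fun _ => DiscretisedMA.value_nonneg _ _ _]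
      refine lintegral_mono fun s' => ?_
      have ht' : k * δ ≤ r - t := by
        have : t < δ := ht
        linarith
      have h0 : 0 ≤ r - t := le_trans (by positivity) ht'
      rw [floorValue, if_pos h0]
      exact ENNReal.ofReal_le_ofReal (DiscretisedMA.value_mono_right n s'
        (Nat.le_floor ((le_div_iff₀ hδ).2 ht')))
    · rw [ENNReal.ofReal_mul (Real.exp_pos _).le]
      gcongr
      -- The self-loop of the discretised automaton uses up a transition although no jump occurred,
      -- so monotonicity in n is needed before the induction hypothesis.
      refine le_trans (ENNReal.ofReal_le_ofReal ?_) (ih (by linarith))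
      exact DiscretisedMA.value_mono_left k s n.le_succ

/-- The policy sees the residence times only through the number of full steps in the remaining time,
so it is a measurable function of the elapsed time. -/
theorem exists_value_le_pathMeasure_reach (M : MarkovAutomaton S Act) (hδ : 0 < δ) (G : Set S)
    (n : ℕ) {b : ℝ} (hb : 0 ≤ b) (s : S) :
    ∃ D : M.GMPolicy, ENNReal.ofReal ((M.discretise δ hδ).value G n ⌊b / δ⌋₊ s) ≤
      M.pathMeasure D s (reach (Set.Icc 0 b) G) := by
  classical
  set N := M.discretise δ hδ with hN
  have hA : ∀ n k s, ∃ l ∈ M.enabled s, s ∉ G → N.value G (n + 1) k s =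
      if l.ticks ≤ k then (N.law s l).mean (N.value G n (k - l.ticks)) else 0 := by
    intro n k s
    by_cases hs : s ∈ G
    · exact ⟨_, (enabled_nonempty (M := M)).some_mem, fun h => absurd hs h⟩
    · obtain ⟨l, hl, h⟩ := DiscretisedMA.exists_value_succ_eq (N := N) hs
        (by rw [enabled_discretise]; exact enabled_nonempty) n k
      rw [enabled_discretise] at hl
      exact ⟨l, hl, fun _ => h⟩
  choose A hAen hA using hA
  have hFm := measurable_floorValue (G := G) (δ := δ) N
  obtain ⟨D, hD⟩ := Policy.exists_le_pathMeasure_hits (en := fun x => M.enabled x.2.2)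
    M.stepKernel (.bot, 0, s) (c := fun y : Elem S Act => (y.2.1 : ℝ)) (by fun_prop)
    (measurableSet_target (G := G) b)
    (W := fun n z => floorValue N δ G n (b - z.2) z.1.2.2)
    (fun n => measurable_remaining (hFm n) b) (by
      rintro i ⟨x, e⟩ ⟨hx, he⟩
      have he' : 0 ≤ b - e := sub_nonneg.2 he
      simp only [floorValue, if_pos he']
      rw [DiscretisedMA.value_of_mem hx, ENNReal.ofReal_one]) (by
      rintro ⟨x, e⟩ hxe
      simp only [floorValue]
      split_ifs with he
      · rw [DiscretisedMA.value_zero_of_notMem fun hx => hxe ⟨hx, sub_nonneg.1 he⟩,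
          ENNReal.ofReal_zero]
      · rfl)
    (fun n z => A n ⌊(b - z.2) / δ⌋₊ z.1.2.2)
    (fun n => measurable_remaining (F := fun r s => A n ⌊r / δ⌋₊ s)
      (fun s => measurable_floor_div δ fun k => A n k s) b)
    (fun n x t => hAen _ _ _) (by
      intro i x e hxe
      by_cases he : 0 ≤ b - e
      · have hxG : x.2.2 ∉ G := fun hx => hxe ⟨hx, sub_nonneg.1 he⟩
        simp only [floorValue.eq_1 N δ G (i + 1), if_pos he]
        have hen := hAen i ⌊(b - e) / δ⌋₊ x.2.2
        have hval := hA i ⌊(b - e) / δ⌋₊ x.2.2 hxG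
        generalize A i ⌊(b - e) / δ⌋₊ x.2.2 = l at hen hval
        cases l with
        | bot =>
          rw [lintegral_stepKernel_bot x hen (hFm i)]
          exact value_le_jump hen hxG i _ ((le_div_iff₀ hδ).1 (Nat.floor_le (by positivity)))
        | act α =>
          rw [lintegral_stepKernel_act (hδ := hδ) x α _ (hFm i), hval]
          simp only [floorValue, if_pos he, StepLabel.ticks, Nat.zero_le, if_true, Nat.sub_zero]
          rw [PMF.lintegral_ofReal _ fun _ => DiscretisedMA.value_nonneg _ _ _]
      · simp only [floorValue.eq_1 N δ G (i + 1), if_neg he]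
        exact zero_le) n
  refine ⟨D, ?_⟩
  simp only [floorValue, sub_zero, if_pos hb] at hD
  rw [reach_Icc_eq]
  exact hD

end MarkovAutomaton


/-! ### Upper bound: at most one Poisson event per interval -/

namespace MarkovAutomaton

variable {S Act : Type*} {G : Set S} [Fintype S] {δ lam : ℝ} {s : S}

/-- A lower bound for the probability of not reaching `G` within `k` intervals of length `δ`: at
most one event of a Poisson process of rate `lam` occurs in each of them with probability
`(exp (-lam δ) (1 + lam δ)) ^ k`, and then the discretised automaton is followed. -/
def avoid (N : DiscretisedMA S Act) (δ lam : ℝ) (G : Set S) (k : ℕ) (s : S) : ℝ :=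
  max 0 ((Real.exp (-(lam * δ)) * (1 + lam * δ)) ^ k - N.limValue G k s)

/-- A lower bound for the probability of not reaching `G` within the remaining time `r`. -/
def avoidBound (N : DiscretisedMA S Act) (δ lam : ℝ) (G : Set S) (r : ℝ) (s : S) : ℝ≥0∞ :=
  if 0 ≤ r then ENNReal.ofReal
    (Real.exp (-(lam * (r - ⌊r / δ⌋₊ * δ))) * avoid N δ lam G ⌊r / δ⌋₊ s) else 1

lemma measurable_avoidBound (N : DiscretisedMA S Act) (s : S) :
    Measurable fun r => avoidBound N δ lam G r s := by
  refine Measurable.ite measurableSet_Ici (Measurable.ennreal_ofReal (Measurable.mul ?_ ?_))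
    measurable_const
  · have := measurable_floor_div δ fun k : ℕ => (k : ℝ)
    fun_prop
  · exact measurable_floor_div δ fun k => avoid N δ lam G k s

lemma poisson_le_one {x : ℝ} : Real.exp (-x) * (1 + x) ≤ 1 := by
  have h := Real.add_one_le_exp x
  calc Real.exp (-x) * (1 + x) ≤ Real.exp (-x) * Real.exp x := by gcongr; linarith
    _ = 1 := by rw [← Real.exp_add]; simp

lemma avoid_nonneg (N : DiscretisedMA S Act) (k : ℕ) : 0 ≤ avoid N δ lam G k s := le_max_left _ _

lemma le_avoid (N : DiscretisedMA S Act) (k : ℕ) :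
    (Real.exp (-(lam * δ)) * (1 + lam * δ)) ^ k - N.limValue G k s ≤ avoid N δ lam G k s :=
  le_max_right _ _

lemma avoid_le_one (N : DiscretisedMA S Act) (hlam : 0 ≤ lam * δ) (k : ℕ) :
    avoid N δ lam G k s ≤ 1 := by
  refine max_le zero_le_one ?_
  have h1 : (Real.exp (-(lam * δ)) * (1 + lam * δ)) ^ k ≤ 1 :=
    pow_le_one₀ (by positivity) poisson_le_one
  linarith [DiscretisedMA.limValue_nonneg (N := N) (G := G) k s]

lemma avoid_of_mem (N : DiscretisedMA S Act) (hlam : 0 ≤ lam * δ) (hs : s ∈ G) (k : ℕ) :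
    avoid N δ lam G k s = 0 := by
  refine max_eq_left ?_
  rw [DiscretisedMA.limValue_of_mem hs, sub_nonpos]
  exact pow_le_one₀ (by positivity) poisson_le_one

lemma avoidBound_le_one (N : DiscretisedMA S Act) (hδ : 0 < δ) (hlam : 0 ≤ lam) (r : ℝ) :
    avoidBound N δ lam G r s ≤ 1 := by
  unfold avoidBound
  split_ifs with hr
  · rw [ENNReal.ofReal_le_one]
    refine mul_le_one₀ (Real.exp_le_one_iff.2 ?_) (avoid_nonneg N _)
      (avoid_le_one N (by positivity) _)
    have := (le_div_iff₀ hδ).1 (Nat.floor_le (div_nonneg hr hδ.le))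
    exact neg_nonpos.2 (mul_nonneg hlam (sub_nonneg.2 this))
  · exact le_rfl

variable [Finite Act]

lemma avoid_le_mean {l : StepLabel Act} (N : DiscretisedMA S Act) (hl : l ∈ N.enabled s)
    (hl0 : l.ticks = 0) (k : ℕ) :
    avoid N δ lam G k s ≤ (N.law s l).mean (avoid N δ lam G k) := by
  refine max_le (PMF.mean_nonneg _ fun _ => avoid_nonneg N k) ?_
  have h := DiscretisedMA.mean_limValue_le (G := G) hl (k := k) (by omega)
  rw [hl0, Nat.sub_zero] at h
  refine (sub_le_sub_left h _).trans ?_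
  rw [← PMF.mean_const_sub]
  exact PMF.mean_mono _ fun _ => le_avoid N k

variable {M : MarkovAutomaton S Act} {hδ : 0 < δ}

/-- The true probability 1 - e^{-Eδ} of a jump in the interval is replaced by the smaller weight
e^{-λδ}Eδ, of one jump followed by no further event. Truncation of `avoid` at 0 makes lowering a
weight harmless. -/
lemma avoid_succ_le (hs : s ∈ M.MS) (hlam : M.exitRate s ≤ lam) (k : ℕ) :
    avoid (M.discretise δ hδ) δ lam G (k + 1) s ≤
      Real.exp (-(lam * δ)) * (M.exitRate s * δ) *
          (M.branch s hs).mean (avoid (M.discretise δ hδ) δ lam G k) +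
        Real.exp (-(M.exitRate s * δ)) * avoid (M.discretise δ hδ) δ lam G k s := by
  set N := M.discretise δ hδ with hN
  set E := M.exitRate s with hEdef
  have hE : 0 < E := M.exitRate_pos hs
  have hx : 0 ≤ (lam - E) * δ := mul_nonneg (sub_nonneg.2 hlam) hδ.le
  set q := Real.exp (-(lam * δ)) * (1 + lam * δ) with hq
  set A := Real.exp (-(lam * δ)) * (E * δ) with hA
  set B := Real.exp (-(E * δ)) with hB
  have hA0 : 0 ≤ A := by positivity
  have hB0 : 0 < B := Real.exp_pos _
  have hAB : A ≤ 1 - B := by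
    have h1 : Real.exp (-(lam * δ)) ≤ B := Real.exp_le_exp.2 (by nlinarith)
    have h2 : B * (1 + E * δ) ≤ 1 := poisson_le_one
    have h3 : A ≤ B * (E * δ) := mul_le_mul_of_nonneg_right h1 (mul_pos hE hδ).le
    linarith
  -- Divided by e^{-λδ}, this is 1 + x ≤ e^x at x = (λ - E)δ.
  have hqAB : q ≤ A + B := by
    have h1 : B = Real.exp (-(lam * δ)) * Real.exp ((lam - E) * δ) := by
      rw [hB, ← Real.exp_add]
      congr 1
      ring
    have h2 := Real.add_one_le_exp ((lam - E) * δ)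
    rw [h1, hA, hq, ← mul_add]
    exact mul_le_mul_of_nonneg_left (by linarith) (Real.exp_pos _).le
  have hq0 : 0 ≤ q ^ k := by
    have : 0 ≤ lam * δ := mul_nonneg (hE.le.trans hlam) hδ.le
    positivity
  have hmean0 : 0 ≤ (M.branch s hs).mean (avoid N δ lam G k) :=
    PMF.mean_nonneg _ fun _ => avoid_nonneg N k
  refine max_le (add_nonneg (mul_nonneg hA0 hmean0) (mul_nonneg hB0.le (avoid_nonneg N k))) ?_
  set m := (M.branch s hs).mean (N.limValue G k) with hm
  have hm0 : 0 ≤ m := PMF.mean_nonneg _ fun _ => DiscretisedMA.limValue_nonneg _ _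
  have h1 : q ^ k - m ≤ (M.branch s hs).mean (avoid N δ lam G k) := by
    rw [hm, ← PMF.mean_const_sub]
    exact PMF.mean_mono _ fun _ => le_avoid N k
  have h2 : q ^ k - N.limValue G k s ≤ avoid N δ lam G k s := le_avoid N k
  have h3 : (1 - B) * m + B * N.limValue G k s ≤ N.limValue G (k + 1) s := by
    have := DiscretisedMA.mean_limValue_le (N := N) (G := G) (s := s) (l := .bot)
      (by rw [enabled_discretise]; exact hs) (k := k + 1) (by simp [StepLabel.ticks])
    rwa [mean_law_bot hs] at this
  -- Altogether A(q^k - m) + B(q^k - V_k(s)) ≥ q^{k+1} - ((1-B)m + B V_k(s)) ≥ q^{k+1} - V_{k+1}(s).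
  have h4 := mul_le_mul_of_nonneg_left h1 hA0
  have h5 := mul_le_mul_of_nonneg_left h2 hB0.le
  have h6 := mul_le_mul_of_nonneg_right hqAB hq0
  have h7 := mul_le_mul_of_nonneg_right hAB hm0
  rw [pow_succ]
  linarith

variable [MeasurableSpace S] [DiscreteMeasurableSpace S]

/-- At a grid point the residence time is split at δ, and the two parts dominate the two terms of
`avoid_succ_le`. With no time remaining, the positive residence time already exceeds the deadline.
-/
lemma avoid_le_jump (hs : s ∈ M.MS) (hlam : M.exitRate s ≤ lam) (k : ℕ) :
    ENNReal.ofReal (avoid (M.discretise δ hδ) δ lam G k s) ≤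
      jump s hs (avoidBound (M.discretise δ hδ) δ lam G) (k * δ) := by
  set N := M.discretise δ hδ with hN
  have hE := M.exitRate_pos hs
  have hlam0 : 0 ≤ lam := hE.le.trans hlam
  induction k with
  | zero =>
    have := isProbabilityMeasure_expMeasure hE
    calc ENNReal.ofReal (avoid N δ lam G 0 s) ≤ 1 :=
          ENNReal.ofReal_le_one.2 (avoid_le_one N (by positivity) 0)
      _ = ∫⁻ _, 1 ∂expMeasure (M.exitRate s) := by simp
      _ ≤ _ := by
        refine lintegral_mono_ae ((ae_expMeasure_pos _).mono fun t ht => ?_)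
        have : ¬ 0 ≤ ((0 : ℕ) : ℝ) * δ - t := by simpa using ht
        simp only [avoidBound, if_neg this, lintegral_one, measure_univ, le_refl]
  | succ k ih =>
    have hr : ((k + 1 : ℕ) : ℝ) * δ - δ = k * δ := by push_cast; ring
    have hmean0 : 0 ≤ (M.branch s hs).mean (avoid N δ lam G k) :=
      PMF.mean_nonneg _ fun _ => avoid_nonneg N k
    have h0 := avoid_nonneg (G := G) (δ := δ) (lam := lam) (s := s) N k
    rw [jump_eq_add hs (measurable_avoidBound N) _ hδ.le, hr]
    refine (ENNReal.ofReal_le_ofReal (avoid_succ_le hs hlam k)).trans ?_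
    rw [ENNReal.ofReal_add (by positivity) (by positivity)]
    refine add_le_add ?_ ?_
    · rw [ENNReal.ofReal_mul (by positivity), mul_comm]
      refine (mul_le_mul_right (le_setLIntegral_expMeasure hE hlam) _).trans ?_
      rw [← lintegral_const_mul _ (by fun_prop)]
      refine lintegral_mono_ae ?_
      -- Positivity of t is essential: at t = 0 the floor below would be k + 1 instead of k.
      filter_upwards [ae_restrict_of_ae (ae_expMeasure_pos _),
        ae_restrict_mem measurableSet_Iio] with t ht0 ht
      have ht : t < δ := ht
      have hk : 0 ≤ (k : ℝ) * δ := by positivity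
      have hpos : 0 ≤ ((k + 1 : ℕ) : ℝ) * δ - t := by linarith
      have hfl : ⌊(((k + 1 : ℕ) : ℝ) * δ - t) / δ⌋₊ = k := by
        rw [Nat.floor_eq_iff (by positivity), le_div_iff₀ hδ, div_lt_iff₀ hδ]
        push_cast at hr ⊢
        constructor <;> linarith
      simp only [avoidBound, if_pos hpos, hfl]
      rw [PMF.lintegral_ofReal _ fun _ => mul_nonneg (Real.exp_pos _).le (avoid_nonneg N k),
        PMF.mean_const_mul, mul_comm, ← ENNReal.ofReal_mul (Real.exp_pos _).le]
      refine le_of_eq ?_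
      congr 4
      push_cast
      ring
    · rw [ENNReal.ofReal_mul (Real.exp_pos _).le]
      gcongr

/-- Jumps before the next grid point are discarded. Staying until then has probability e^{-Ec} ≥
e^{-λc}, and the remaining time is then a multiple of δ. -/
lemma avoidBound_le_jump (hs : s ∈ M.MS) (hlam : M.exitRate s ≤ lam) (r : ℝ) :
    avoidBound (M.discretise δ hδ) δ lam G r s ≤
      jump s hs (avoidBound (M.discretise δ hδ) δ lam G) r := by
  set N := M.discretise δ hδ with hN
  have hE := M.exitRate_pos hs
  rw [avoidBound]
  split_ifs with hr
  · have hc : 0 ≤ r - ⌊r / δ⌋₊ * δ :=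
      sub_nonneg.2 ((le_div_iff₀ hδ).1 (Nat.floor_le (div_nonneg hr hδ.le)))
    rw [jump_eq_add hs (measurable_avoidBound N) r hc, sub_sub_cancel,
      ENNReal.ofReal_mul (Real.exp_pos _).le]
    refine le_add_left (mul_le_mul' (ENNReal.ofReal_le_ofReal (Real.exp_le_exp.2 ?_))
      (avoid_le_jump hs hlam _))
    exact neg_le_neg (mul_le_mul_of_nonneg_right hlam hc)
  · have := isProbabilityMeasure_expMeasure hE
    calc (1 : ℝ≥0∞) = ∫⁻ _, 1 ∂expMeasure (M.exitRate s) := by simp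
      _ ≤ _ := by
        refine lintegral_mono_ae ((ae_expMeasure_pos _).mono fun t ht => ?_)
        have : ¬ 0 ≤ r - t := by linarith
        simp only [avoidBound, if_neg this, lintegral_one, measure_univ, le_refl]

/-- `avoidBound` of the remaining time is a subsolution for every enabled label:
`avoidBound_le_jump` handles Markovian states and `avoid_le_mean` the instantaneous transitions. -/
theorem pathMeasure_reach_add_le (hδ : 0 < δ) (hlam : ∀ s ∈ M.MS, M.exitRate s ≤ lam)
    (hlam0 : 0 ≤ lam) (D : M.GMPolicy) (b : ℝ) (s : S) :
    M.pathMeasure D s (reach (Set.Icc 0 b) G) + avoidBound (M.discretise δ hδ) δ lam G b s ≤ 1 := by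
  set N := M.discretise δ hδ with hN
  have h := Policy.pathMeasure_hits_add_le D M.stepKernel (.bot, 0, s)
    (c := fun y : Elem S Act => (y.2.1 : ℝ)) (by fun_prop) (measurableSet_target (G := G) b)
    (W := fun z => avoidBound N δ lam G (b - z.2) z.1.2.2)
    (measurable_remaining (measurable_avoidBound N) b) (by
      rintro ⟨x, e⟩ ⟨hx, he⟩
      have he' : 0 ≤ b - e := sub_nonneg.2 he
      simp only [avoidBound, if_pos he']
      rw [avoid_of_mem N (by positivity) hx, mul_zero, ENNReal.ofReal_zero])
    (fun z => avoidBound_le_one N hδ hlam0 _) (by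
      intro x e hxe l hl
      cases l with
      | bot =>
        rw [lintegral_stepKernel_bot x hl (measurable_avoidBound N)]
        exact avoidBound_le_jump hl (hlam _ hl) _
      | act α =>
        rw [lintegral_stepKernel_act (hδ := hδ) x α _ (measurable_avoidBound N)]
        simp only [avoidBound]
        split_ifs with he
        · rw [PMF.lintegral_ofReal _ fun _ => mul_nonneg (Real.exp_pos _).le (avoid_nonneg N _),
            PMF.mean_const_mul]
          gcongr
          exact avoid_le_mean N (by rw [enabled_discretise]; exact hl) rfl _
        · simp)
  simp only [sub_zero] at h
  rw [reach_Icc_eq]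
  exact h

end MarkovAutomaton

/-! ### The two-sided estimate -/

open MarkovAutomaton in
theorem theorem5p3 {S Act : Type*} [Fintype S] [MeasurableSpace S] [DiscreteMeasurableSpace S]
    [Finite Act] (M : MarkovAutomaton S Act) (G : Set S)
    (lam : ℝ) (hlam : IsGreatest (M.exitRate '' M.MS) lam)
    (b δ : ℝ) (hδ : 0 < δ) (k : ℕ) (hb : b = k * δ) (s : S) :
    (M.discretise δ hδ).pmax s k G ≤ M.pmax s (Set.Icc 0 b) G ∧
      M.pmax s (Set.Icc 0 b) G ≤
        (M.discretise δ hδ).pmax s k G + (1 - Real.exp (-(lam * b)) * (1 + lam * δ) ^ k) := by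
  have hb0 : 0 ≤ b := hb ▸ by positivity
  have hfl : ⌊b / δ⌋₊ = k := by rw [hb, mul_div_cancel_right₀ _ hδ.ne', Nat.floor_natCast]
  constructor
  · refine (DiscretisedMA.pmax_le_limValue k s).trans (ciSup_le fun n => ?_)
    obtain ⟨D, hD⟩ := exists_value_le_pathMeasure_reach M hδ G n hb0 s
    rw [hfl] at hD
    refine (ENNReal.ofReal_le_iff_le_toReal ?_).1
      (hD.trans (le_iSup (fun D : M.GMPolicy => M.pathMeasure D s (reach (Set.Icc 0 b) G)) D))
    refine ne_top_of_le_ne_top ENNReal.one_ne_top (iSup_le fun D => ?_)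
    have : IsProbabilityMeasure (M.pathMeasure D s) :=
      inferInstanceAs (IsProbabilityMeasure (Policy.pathMeasure D M.stepKernel _))
    exact prob_le_one
  · obtain ⟨s₀, hs₀, hs₀lam⟩ := hlam.1
    have hlam0 : 0 ≤ lam := hs₀lam ▸ (M.exitRate_pos hs₀).le
    set N := M.discretise δ hδ with hN
    have hq : (Real.exp (-(lam * δ)) * (1 + lam * δ)) ^ k =
        Real.exp (-(lam * b)) * (1 + lam * δ) ^ k := by
      rw [mul_pow, ← Real.exp_nat_mul, hb]
      congr 2
      ring
    have h1 : N.limValue G k s ≤ N.pmax s k G :=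
      DiscretisedMA.limValue_le_pmax (N := N) (fun _ => by rw [enabled_discretise]; exact enabled_nonempty) k s
    have h2 := le_avoid (G := G) (δ := δ) (lam := lam) (s := s) N k
    have h4 := avoid_le_one (G := G) (s := s) N (mul_nonneg hlam0 hδ.le) k
    have h3 : M.pmax s (Set.Icc 0 b) G ≤ 1 - avoid N δ lam G k s := by
      refine ENNReal.toReal_le_of_le_ofReal (sub_nonneg.2 h4) (iSup_le fun D => ?_)
      have h := pathMeasure_reach_add_le (G := G) hδ
        (fun s hs => hlam.2 (Set.mem_image_of_mem _ hs)) hlam0 D b s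
      -- As b is a multiple of δ, the factor for the partial interval is 1.
      rw [avoidBound, if_pos hb0, hfl, hb, sub_self, mul_zero, neg_zero, Real.exp_zero, one_mul,
        ← hb] at h
      rw [ENNReal.ofReal_sub _ (avoid_nonneg N k), ENNReal.ofReal_one]
      exact ENNReal.le_sub_of_add_le_right ENNReal.ofReal_ne_top h
    rw [hq] at h2
    linarith

end
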